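/- **Conventions.** Let $\mathcal Q$ be a (small) quantaloid, i.e. a small category whose hom-sets are complete lattices and whose composition preserves suprema in each variable. For arrows of $\mathcal Q$, $\{f,h\}$ denotes the largest $g$ with $g\circ f\le h$, and $[g,h]$ the largest $f$ with $g\circ f\le h$. A *$\mathcal Q$-semicategory* $\mathbb A$ is a set of objects $a$ with types $ta\in\mathcal Q_0$ and arrows $\mathbb A(a',a)\colon ta\to ta'$ with $\mathbb A(a'',a')\circ\mathbb A(a',a)\le\mathbb A(a'',a)$. It is *regular* if $\bigvee_{a'}\mathbb A(a'',a')\circ\mathbb A(a',a)=\mathbb A(a'',a)$, and a *$\mathcal Q$-category* if $1_{ta}\le\mathbb A(a,a)$. A functor $F\colon\mathbb A\to\mathbb B$ of $\mathcal Q$-categories is a type-preserving map on objects with $\mathbb A(a',a)\le\mathbb B(Fa',Fa)$; functors are preordered by $F\le G$ iff $1_{ta}\le\mathbb B(Fa,Ga)$ for all $a$. A distributor $\Phi\colon\mathbb A\to\mathbb B$ of $\mathcal Q$-categories consists of arrows $\Phi(b,a)\colon ta\to tb$ with $\mathbb B(b',b)\circ\Phi(b,a)\le\Phi(b',a)$ and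 $\Phi(b,a)\circ\mathbb A(a,a')\le\Phi(b,a')$; put $(\Psi\otimes\Phi)(c,a)=\bigvee_b\Psi(c,b)\circ\Phi(b,a)$. A regular semidistributor $\Phi\colon\mathbb A\to\mathbb B$ between regular semicategories consists of such arrows with $\mathbb B\otimes\Phi=\Phi=\Phi\otimes\mathbb A$. With the elementwise order these form the locally ordered categories $\mathsf{Dist}(\mathcal Q)$ ($\mathcal Q$-categories, distributors) and $\mathsf{RSDist}(\mathcal Q)$ (regular $\mathcal Q$-semicategories, regular semidistributors). A presheaf of type $X$ on $\mathbb A$ is a family $\phi(a)\colon X\to ta$ with $\mathbb A(a',a)\circ\phi(a)\le\phi(a')$; it is regular if $\bigvee_a\mathbb A(a',a)\circ\phi(a)=\phi(a')$. Presheaves form the $\mathcal Q$-category $\mathcal P\mathbb A$ with $\mathcal P\mathbb A(\psi,\phi)=\bigwedge_a[\psi(a),\phi(a)]$, and $\mathcal R\mathbb A$ is its full subcategory of regular presheaves. A functor $K$ is the colimit of $F\colon\mathbb C\to\mathbb A$ weighted by $\Phi\colon\mathbb X\to\mathbb C$ if $\mathbb A(Kx,a)=\bigwedge_c[\Phi(c,x),\mathbb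 A(Fc,a)]$ for all $x,a$. $\mathsf{Cocont}(\mathcal Q)$ is the locally (pre)ordered category of $\mathcal Q$-categories having all small weighted colimits (*cocomplete*) and functors preserving them (*cocontinuous*); $\simeq$ denotes equivalence in $\mathsf{Cocont}(\mathcal Q)$. Let $\mathbb A$ be cocomplete, $Y_{\mathbb A}\colon\mathbb A\to\mathcal P\mathbb A$, $a\mapsto\mathbb A(-,a)$ the Yoneda embedding, and $\sup_{\mathbb A}\colon\mathcal P\mathbb A\to\mathbb A$, $\phi\mapsto\mathrm{colim}(\phi,1_{\mathbb A})$, its left adjoint. * $\mathbb A$ is *projective* in $\mathsf{Cocont}(\mathcal Q)$ if every arrow $\mathbb A\to\mathbb B$ of $\mathsf{Cocont}(\mathcal Q)$ factors, up to isomorphism, through every epimorphism $G\colon\mathbb C\to\mathbb B$ of $\mathsf{Cocont}(\mathcal Q)$, where $G$ is an epimorphism if $H\circ G\cong K\circ G$ implies $H\cong K$. * $\mathbb A$ is *completely distributive* if $\sup_{\mathbb A}$ has a left adjoint functor. * The *totally-below relation* is $\Theta_{\mathbb A}(a',a)=\bigwedge_{\phi\in\mathcal P\mathbb A}\{\mathbb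 A(a,\sup_{\mathbb A}\phi),\mathcal P\mathbb A(Y_{\mathbb A}a',\phi)\}$, and $\mathbb A$ is *totally continuous* if $\sup_{\mathbb A}(\Theta_{\mathbb A}(-,a))\cong a$ for all $a$. * An object $a$ is *totally compact* if $1_{ta}\le\Theta_{\mathbb A}(a,a)$. Put $\Sigma_{\mathbb A}(a',a)=\bigvee_c\mathbb A(a',c)\circ\mathbb A(c,a)$, where $c$ ranges over the totally compact objects; $\mathbb A$ is *totally algebraic* if $\sup_{\mathbb A}(\Sigma_{\mathbb A}(-,a))\cong a$ for all $a$. **Theorem.** For a cocomplete $\mathcal Q$-category $\mathbb A$, the following are equivalent: 1. $\mathbb A$ is projective in $\mathsf{Cocont}(\mathcal Q)$; 2. $\mathbb A$ is completely distributive; 3. $\mathbb A$ is totally continuous; 4. $\mathbb A\simeq\mathcal R\mathbb B$ for some regular $\mathcal Q$-semicategory $\mathbb B$. Moreover, $\mathbb A$ is totally algebraic if and only if $\mathbb A\simeq\mathcal P\mathbb C$ for some $\mathcal Q$-category $\mathbb C$; and every totally algebraic cocomplete $\mathcal Q$-category is totally continuous. Consequently, let $\mathsf{Cocont}_{\mathsf{tc}}(\mathcal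 Q)$ and $\mathsf{Cocont}_{\mathsf{ta}}(\mathcal Q)$ be the full sub-2-categories of $\mathsf{Cocont}(\mathcal Q)$ on the totally continuous, respectively totally algebraic, objects. The 2-functors $$\mathsf{RSDist}(\mathcal Q)\to\mathsf{Cocont}(\mathcal Q),\ (\Phi\colon\mathbb A\to\mathbb B)\mapsto(\Phi\otimes-\colon\mathcal R\mathbb A\to\mathcal R\mathbb B),\qquad \mathsf{Dist}(\mathcal Q)\to\mathsf{Cocont}(\mathcal Q),\ (\Phi\colon\mathbb A\to\mathbb B)\mapsto(\Phi\otimes-\colon\mathcal P\mathbb A\to\mathcal P\mathbb B)$$ take values in $\mathsf{Cocont}_{\mathsf{tc}}(\mathcal Q)$ and $\mathsf{Cocont}_{\mathsf{ta}}(\mathcal Q)$ respectively, and their corestrictions $$\mathsf{RSDist}(\mathcal Q)\to\mathsf{Cocont}_{\mathsf{tc}}(\mathcal Q),\qquad \mathsf{Dist}(\mathcal Q)\to\mathsf{Cocont}_{\mathsf{ta}}(\mathcal Q)$$ are biequivalences (locally equivalences, and surjective on objects up to equivalence). The inclusions $\mathsf{Dist}(\mathcal Q)\to\mathsf{RSDist}(\mathcal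 Q)$ and $\mathsf{Cocont}_{\mathsf{ta}}(\mathcal Q)\to\mathsf{Cocont}_{\mathsf{tc}}(\mathcal Q)$ are full 2-inclusions, and the square formed by these four 2-functors commutes, up to the pseudonatural equivalence whose components are the identifications $\mathcal P\mathbb C\to\mathcal R\mathbb C$, $\phi\mapsto\phi$, for $\mathcal Q$-categories $\mathbb C$. -/

import Mathlib

open CategoryTheory Bicategory

universe u

/-- A (small) quantaloid: a small category whose hom-sets are complete lattices (suplattices)
and whose composition preserves arbitrary suprema in each variable. -/
class Quantaloid (Q : Type u) extends Category.{u} Q where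
  /-- The complete lattice structure on the hom-sets. -/
  homLattice : ∀ X Y : Q, CompleteLattice (X ⟶ Y)
  comp_sSup : ∀ {X Y Z : Q} (f : X ⟶ Y) (S : Set (Y ⟶ Z)), f ≫ sSup S = ⨆ g ∈ S, f ≫ g
  sSup_comp : ∀ {X Y Z : Q} (S : Set (X ⟶ Y)) (g : Y ⟶ Z), sSup S ≫ g = ⨆ f ∈ S, f ≫ g

attribute [reducible, instance] Quantaloid.homLattice

namespace QEnriched

section Quantaloid

variable {Q : Type u} [Quantaloid Q]

theorem comp_iSup {ι : Sort*} {X Y Z : Q} (f : X ⟶ Y) (g : ι → (Y ⟶ Z)) :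
    f ≫ (⨆ i, g i) = ⨆ i, f ≫ g i := by
  rw [iSup, Quantaloid.comp_sSup, iSup_range]

theorem iSup_comp {ι : Sort*} {X Y Z : Q} (f : ι → (X ⟶ Y)) (g : Y ⟶ Z) :
    (⨆ i, f i) ≫ g = ⨆ i, f i ≫ g := by
  rw [iSup, Quantaloid.sSup_comp, iSup_range]

theorem comp_le_comp_left {X Y Z : Q} (f : X ⟶ Y) {g h : Y ⟶ Z} (H : g ≤ h) :
    f ≫ g ≤ f ≫ h := by
  have : h = sSup {g, h} := by simp [H]
  rw [this, Quantaloid.comp_sSup]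
  exact le_iSup₂_of_le g (by simp) le_rfl

theorem comp_le_comp_right {X Y Z : Q} {f g : X ⟶ Y} (H : f ≤ g) (h : Y ⟶ Z) :
    f ≫ h ≤ g ≫ h := by
  have : g = sSup {f, g} := by simp [H]
  rw [this, Quantaloid.sSup_comp]
  exact le_iSup₂_of_le f (by simp) le_rfl

/-- The right lifting `[g, h]`: the largest arrow `f` with `g ∘ f ≤ h`. -/
def rightLift {X Y Z : Q} (g : Y ⟶ Z) (h : X ⟶ Z) : X ⟶ Y := sSup {f | f ≫ g ≤ h}

/-- The right extension `{f, h}`: the largest arrow `g` with `g ∘ f ≤ h`. -/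
def rightExt {X Y Z : Q} (f : X ⟶ Y) (h : X ⟶ Z) : Y ⟶ Z := sSup {g | f ≫ g ≤ h}

theorem le_rightLift {X Y Z : Q} {f : X ⟶ Y} {g : Y ⟶ Z} {h : X ⟶ Z} :
    f ≤ rightLift g h ↔ f ≫ g ≤ h := by
  constructor
  · intro H
    refine (comp_le_comp_right H g).trans ?_
    rw [rightLift, Quantaloid.sSup_comp]
    exact iSup₂_le fun _ hf => hf
  · intro H
    exact le_sSup H

theorem le_rightExt {X Y Z : Q} {f : X ⟶ Y} {g : Y ⟶ Z} {h : X ⟶ Z} :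
    g ≤ rightExt f h ↔ f ≫ g ≤ h := by
  constructor
  · intro H
    refine (comp_le_comp_left f H).trans ?_
    rw [rightExt, Quantaloid.comp_sSup]
    exact iSup₂_le fun _ hf => hf
  · intro H
    exact le_sSup H

end Quantaloid

/-! ### Semicategories, categories, distributors, functors

Composition in `Q` is written in diagrammatic order: `f ≫ g` is `g ∘ f`. -/

/-- A `Q`-semicategory. A set of objects typed by the objects of `Q` is given by its fibres:
`obj X` is the set of objects of type `X`. The arrow `hom b a : ta ⟶ tb` is usually written
`A(b, a)`. -/
structure QSemicategory (Q : Type u) [Quantaloid Q] where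
  /-- The objects of a given type. -/
  obj : Q → Type u
  /-- The hom-arrows. -/
  hom : ∀ {X Y : Q}, obj Y → obj X → (X ⟶ Y)
  comp_le : ∀ {X Y Z : Q} (a : obj X) (b : obj Y) (c : obj Z), hom b a ≫ hom c b ≤ hom c a

/-- A `Q`-category: a `Q`-semicategory with identity inequalities. -/
structure QCategory (Q : Type u) [Quantaloid Q] extends QSemicategory Q where
  id_le : ∀ {X : Q} (a : obj X), 𝟙 X ≤ hom a a

/-- A regular `Q`-semicategory: the composition inequality is an equality `A ⊗ A = A`. -/
structure RegularQSemicategory (Q : Type u) [Quantaloid Q] extends QSemicategory Q where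
  regular : ∀ {X Z : Q} (a : obj X) (c : obj Z),
    ⨆ (Y : Q) (b : obj Y), hom b a ≫ hom c b = hom c a

variable {Q : Type u} [Quantaloid Q]

/-- A (semi)distributor `Φ : A ⇸ B`, with elements `app b a : ta ⟶ tb`, usually written
`Φ(b, a)`. -/
@[ext]
structure Distributor (A B : QSemicategory Q) where
  /-- The elements of the distributor. -/
  app : ∀ {X Y : Q}, B.obj Y → A.obj X → (X ⟶ Y)
  app_hom_le : ∀ {X Y Z : Q} (a : A.obj X) (b : B.obj Y) (c : B.obj Z),
    app b a ≫ B.hom c b ≤ app c a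
  hom_app_le : ∀ {X Y Z : Q} (a : A.obj X) (b : A.obj Y) (c : B.obj Z),
    A.hom b a ≫ app c b ≤ app c a

/-- Distributors are ordered elementwise. -/
instance (A B : QSemicategory Q) : PartialOrder (Distributor A B) where
  le Φ Ψ := ∀ ⦃X Y : Q⦄ (b : B.obj Y) (a : A.obj X), Φ.app b a ≤ Ψ.app b a
  le_refl _ _ _ _ _ := le_rfl
  le_trans _ _ _ h k _ _ b a := (h b a).trans (k b a)
  le_antisymm _ _ h k := Distributor.ext (by
    funext X Y b a
    exact le_antisymm (h b a) (k b a))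

/-- The composite `Ψ ⊗ Φ`, with elements `(Ψ ⊗ Φ)(c, a) = ⋁_b Ψ(c, b) ∘ Φ(b, a)`. -/
def Distributor.comp {A B C : QSemicategory Q} (Φ : Distributor A B) (Ψ : Distributor B C) :
    Distributor A C where
  app c a := ⨆ (Y : Q) (b : B.obj Y), Φ.app b a ≫ Ψ.app c b
  app_hom_le a c d := by
    simp only [iSup_comp, Category.assoc]
    exact iSup₂_mono fun Y b => comp_le_comp_left _ (Ψ.app_hom_le b c d)
  hom_app_le a b c := by
    simp only [comp_iSup, ← Category.assoc]
    exact iSup₂_mono fun Y d => comp_le_comp_right (Φ.hom_app_le a b d) _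

theorem Distributor.comp_assoc {A B C D : QSemicategory Q} (Φ : Distributor A B)
    (Ψ : Distributor B C) (Χ : Distributor C D) :
    (Φ.comp Ψ).comp Χ = Φ.comp (Ψ.comp Χ) := by
  refine Distributor.ext ?_
  funext X Y d a
  simp only [Distributor.comp, iSup_comp, comp_iSup, Category.assoc]
  apply le_antisymm
  · exact iSup₂_le fun Z c => iSup₂_le fun W b =>
      le_iSup₂_of_le W b (le_iSup₂_of_le Z c le_rfl)
  · exact iSup₂_le fun Z c => iSup₂_le fun W b =>
      le_iSup₂_of_le W b (le_iSup₂_of_le Z c le_rfl)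

theorem Distributor.comp_mono {A B C : QSemicategory Q} {Φ Φ₁ : Distributor A B}
    {Ψ Ψ₁ : Distributor B C} (h : Φ ≤ Φ₁) (k : Ψ ≤ Ψ₁) : Φ.comp Ψ ≤ Φ₁.comp Ψ₁ := by
  intro X Y c a
  exact iSup₂_mono fun Z b =>
    (comp_le_comp_right (h b a) _).trans (comp_le_comp_left _ (k c b))

/-- The hom-arrows of `A`, as a distributor `A ⇸ A`. -/
def Distributor.homs (A : QSemicategory Q) : Distributor A A where
  app b a := A.hom b a
  app_hom_le := A.comp_le
  hom_app_le := A.comp_le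

theorem Distributor.homs_comp (A : QCategory Q) {B : QSemicategory Q}
    (Φ : Distributor A.toQSemicategory B) :
    (Distributor.homs A.toQSemicategory).comp Φ = Φ := by
  apply le_antisymm
  · intro X Y b a
    exact iSup₂_le fun Z c => Φ.hom_app_le a c b
  · intro X Y b a
    refine le_iSup₂_of_le X a ?_
    have h := comp_le_comp_right (A.id_le a) (Φ.app b a)
    rwa [Category.id_comp] at h

theorem Distributor.comp_homs {A : QSemicategory Q} (B : QCategory Q)
    (Φ : Distributor A B.toQSemicategory) :
    Φ.comp (Distributor.homs B.toQSemicategory) = Φ := by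
  apply le_antisymm
  · intro X Y b a
    exact iSup₂_le fun Z c => Φ.app_hom_le a c b
  · intro X Y b a
    refine le_iSup₂_of_le Y b ?_
    have h := comp_le_comp_left (Φ.app b a) (B.id_le b)
    rwa [Category.comp_id] at h

/-- A functor between `Q`-categories: a type-preserving map on objects with
`A(b, a) ≤ B(F b, F a)`. -/
@[ext]
structure QFunctor (A B : QCategory Q) where
  /-- The action on objects. -/
  obj : ∀ {X : Q}, A.obj X → B.obj X
  hom_le : ∀ {X Y : Q} (b : A.obj Y) (a : A.obj X), A.hom b a ≤ B.hom (obj b) (obj a)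

/-- The local order on functors: `F ≤ G` if `1 ≤ B(F a, G a)` for all objects `a`. -/
instance (A B : QCategory Q) : Preorder (QFunctor A B) where
  le F G := ∀ ⦃X : Q⦄ (a : A.obj X), 𝟙 X ≤ B.hom (F.obj a) (G.obj a)
  le_refl F _ a := B.id_le (F.obj a)
  le_trans F G H h k X a := by
    have h1 := (comp_le_comp_right (k a) (B.hom (F.obj a) (G.obj a))).trans (B.comp_le _ _ _)
    rw [Category.id_comp] at h1
    exact (h a).trans h1

/-- Isomorphism of parallel functors. -/
def QFunctor.Iso {A B : QCategory Q} (F G : QFunctor A B) : Prop := F ≤ G ∧ G ≤ F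

/-- The identity functor. -/
def QFunctor.id (A : QCategory Q) : QFunctor A A where
  obj a := a
  hom_le _ _ := le_rfl

/-- The composite `G ∘ F`. -/
def QFunctor.comp {A B C : QCategory Q} (F : QFunctor A B) (G : QFunctor B C) :
    QFunctor A C where
  obj a := G.obj (F.obj a)
  hom_le b a := (F.hom_le b a).trans (G.hom_le _ _)

/-- The adjunction `F ⊣ G` between functors of `Q`-categories. -/
def QFunctor.Adjoint {A B : QCategory Q} (F : QFunctor A B) (G : QFunctor B A) : Prop :=
  QFunctor.id A ≤ F.comp G ∧ G.comp F ≤ QFunctor.id B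

theorem QFunctor.comp_mono {A B C : QCategory Q} {F F₁ : QFunctor A B} {G G₁ : QFunctor B C}
    (h : F ≤ F₁) (k : G ≤ G₁) : F.comp G ≤ F₁.comp G₁ := by
  intro X a
  have h1 : 𝟙 X ≤ C.hom (G.obj (F.obj a)) (G.obj (F₁.obj a)) := (h a).trans (G.hom_le _ _)
  have h2 := (comp_le_comp_right (k (F₁.obj a)) (C.hom (G.obj (F.obj a)) (G.obj (F₁.obj a)))).trans
    (C.comp_le _ _ _)
  rw [Category.id_comp] at h2
  exact h1.trans h2

/-- The distributor `B(-, F-) : A ⇸ B` induced by a functor `F`. -/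
def QFunctor.graph {A B : QCategory Q} (F : QFunctor A B) :
    Distributor A.toQSemicategory B.toQSemicategory where
  app b a := B.hom b (F.obj a)
  app_hom_le _ _ _ := B.comp_le _ _ _
  hom_app_le a b _ := (comp_le_comp_right (F.hom_le b a) _).trans (B.comp_le _ _ _)

/-- The distributor `B(F-, -) : B ⇸ A` induced by a functor `F`. -/
def QFunctor.cograph {A B : QCategory Q} (F : QFunctor A B) :
    Distributor B.toQSemicategory A.toQSemicategory where
  app a b := B.hom (F.obj a) b
  app_hom_le _ b c := (comp_le_comp_left _ (F.hom_le c b)).trans (B.comp_le _ _ _)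
  hom_app_le _ _ _ := B.comp_le _ _ _

/-- The right extension `{Φ, Ψ} : B ⇸ C` of `Ψ : A ⇸ C` through `Φ : A ⇸ B`, i.e. the largest
distributor `Χ` with `Χ ⊗ Φ ≤ Ψ`; its elements are `⋀_a {Φ(b, a), Ψ(c, a)}`. -/
def Distributor.rightExtension {A B C : QSemicategory Q} (Φ : Distributor A B)
    (Ψ : Distributor A C) : Distributor B C where
  app c b := ⨅ (X : Q) (a : A.obj X), rightExt (Φ.app b a) (Ψ.app c a)
  app_hom_le b c d := le_iInf₂ fun X a => by
    rw [le_rightExt, ← Category.assoc]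
    refine (comp_le_comp_right ?_ _).trans (Ψ.app_hom_le a c d)
    exact le_rightExt.1 (iInf₂_le X a)
  hom_app_le b b₁ c := le_iInf₂ fun X a => by
    rw [le_rightExt, ← Category.assoc]
    refine (comp_le_comp_right (Φ.app_hom_le a b b₁) _).trans ?_
    exact le_rightExt.1 (iInf₂_le X a)

/-! ### Weighted colimits -/

/-- `K` is the `Φ`-weighted colimit of `F`, where `Φ : X ⇸ C` and `F : C ⟶ A`:
`A(K-, -) = [Φ, A(F-, -)]`, the right lifting of `A(F-, -)` through `Φ`. -/
def IsColimit {X C A : QCategory Q} (Φ : Distributor X.toQSemicategory C.toQSemicategory)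
    (F : QFunctor C A) (K : QFunctor X A) : Prop :=
  ∀ ⦃Y Z : Q⦄ (x : X.obj Y) (a : A.obj Z),
    A.hom (K.obj x) a =
      ⨅ (W : Q) (c : C.obj W), rightLift (Φ.app c x) (A.hom (F.obj c) a)

/-- A `Q`-category is cocomplete when it has all (small) weighted colimits. -/
def IsCocomplete (A : QCategory Q) : Prop :=
  ∀ (X C : QCategory Q) (Φ : Distributor X.toQSemicategory C.toQSemicategory)
    (F : QFunctor C A), ∃ K : QFunctor X A, IsColimit Φ F K

/-- A functor is cocontinuous when it preserves all weighted colimits that exist in its domain. -/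
def IsCocontinuous {A B : QCategory Q} (G : QFunctor A B) : Prop :=
  ∀ (X C : QCategory Q) (Φ : Distributor X.toQSemicategory C.toQSemicategory)
    (F : QFunctor C A) (K : QFunctor X A),
    IsColimit Φ F K → IsColimit Φ (F.comp G) (K.comp G)

/-! ### Presheaves and regular presheaves -/

/-- A (contravariant) presheaf of type `X` on `A`: a distributor from the one-object
`Q`-category on `X` (whose hom-arrow is `1_X`) to `A`. -/
@[ext]
structure Presheaf (A : QSemicategory Q) (X : Q) where
  /-- The elements of the presheaf. -/
  app : ∀ {Y : Q}, A.obj Y → (X ⟶ Y)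
  app_hom_le : ∀ {Y Z : Q} (a : A.obj Y) (b : A.obj Z), app a ≫ A.hom b a ≤ app b

/-- A presheaf is regular if `A ⊗ φ = φ`. -/
def Presheaf.IsRegular {A : QSemicategory Q} {X : Q} (φ : Presheaf A X) : Prop :=
  ∀ {Z : Q} (b : A.obj Z), ⨆ (Y : Q) (a : A.obj Y), φ.app a ≫ A.hom b a = φ.app b

/-- The `Q`-category `P A` of presheaves on `A`, with hom-arrows
`P A (ψ, φ) = [ψ, φ] = ⋀_a [ψ(a), φ(a)]`. -/
abbrev presheafCategory (A : QSemicategory Q) : QCategory Q where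
  obj X := Presheaf A X
  hom ψ φ := ⨅ (Y : Q) (a : A.obj Y), rightLift (ψ.app a) (φ.app a)
  comp_le φ ψ χ := le_iInf₂ fun Y a => by
    rw [le_rightLift, Category.assoc]
    refine (comp_le_comp_left _ (le_rightLift.1 (iInf₂_le Y a))).trans ?_
    exact le_rightLift.1 (iInf₂_le Y a)
  id_le φ := le_iInf₂ fun Y a => by
    rw [le_rightLift, Category.id_comp]

/-- The `Q`-category `R A` of regular presheaves on `A`: the full subcategory of `P A` on the
regular presheaves. -/
abbrev regularPresheafCategory (A : QSemicategory Q) : QCategory Q where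
  obj X := {φ : Presheaf A X // φ.IsRegular}
  hom ψ φ := (presheafCategory A).hom ψ.1 φ.1
  comp_le φ ψ χ := (presheafCategory A).comp_le φ.1 ψ.1 χ.1
  id_le φ := (presheafCategory A).id_le φ.1

/-- The Yoneda embedding `a ↦ A(-, a)`. -/
def yonedaFunctor (A : QCategory Q) : QFunctor A (presheafCategory A.toQSemicategory) where
  obj a :=
    { app := fun b => A.hom b a
      app_hom_le := fun b c => A.comp_le a b c }
  hom_le b a := le_iInf₂ fun _ c => le_rightLift.2 (A.comp_le a b c)

/-- The functor `A ⟶ P B`, `a ↦ Φ(-, a)`, corresponding to a distributor `Φ : A ⇸ B`. -/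
def Distributor.toFunctor {A : QCategory Q} {B : QSemicategory Q}
    (Φ : Distributor A.toQSemicategory B) : QFunctor A (presheafCategory B) where
  obj a :=
    { app := fun b => Φ.app b a
      app_hom_le := fun b c => Φ.app_hom_le a b c }
  hom_le b a := le_iInf₂ fun _ c => le_rightLift.2 (Φ.hom_app_le a b c)

/-! ### Locally ordered bicategories -/

/-- The bicategory determined by a category with preordered hom-sets and monotone composition:
there is a (unique) 2-cell `f ⟶ g` precisely when `f ≤ g`. -/
abbrev locallyOrderedBicategory {B : Type*} [Category.{u} B] [∀ a b : B, Preorder (a ⟶ b)]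
    (mono : ∀ {a b c : B} {f f₁ : a ⟶ b} {g g₁ : b ⟶ c},
      f ≤ f₁ → g ≤ g₁ → f ≫ g ≤ f₁ ≫ g₁) : Bicategory.{u, u} B where
  homCategory _ _ := Preorder.smallCategory _
  whiskerLeft _ _ _ η := homOfLE (mono le_rfl (leOfHom η))
  whiskerRight η _ := homOfLE (mono (leOfHom η) le_rfl)
  associator f g h := eqToIso (Category.assoc f g h)
  leftUnitor f := eqToIso (Category.id_comp f)
  rightUnitor f := eqToIso (Category.comp_id f)

/-! ### The quantaloid of categories and distributors -/

variable (Q) in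
/-- The objects of `Dist(Q)`: the `Q`-categories. -/
abbrev DistCat : Type (u + 1) := QCategory Q

instance : Category.{u} (DistCat Q) where
  Hom A B := Distributor (QCategory.toQSemicategory A) (QCategory.toQSemicategory B)
  id A := Distributor.homs (QCategory.toQSemicategory A)
  comp Φ Ψ := Distributor.comp Φ Ψ
  id_comp {A _} Φ := Distributor.homs_comp A Φ
  comp_id {_ B} Φ := Distributor.comp_homs B Φ
  assoc Φ Ψ Χ := Distributor.comp_assoc Φ Ψ Χ

instance (A B : DistCat Q) : PartialOrder (A ⟶ B) :=
  inferInstanceAs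
    (PartialOrder (Distributor (QCategory.toQSemicategory A) (QCategory.toQSemicategory B)))

/-- `Dist(Q)`: `Q`-categories, distributors, and the elementwise order. -/
instance : Bicategory.{u, u} (DistCat Q) :=
  locallyOrderedBicategory fun h k => Distributor.comp_mono h k

/-! ### The quantaloid of regular semicategories and regular semidistributors -/

/-- A regular semidistributor `Φ : A ⇸ B` between regular semicategories:
`Φ ⊗ A = Φ` and `B ⊗ Φ = Φ`. -/
structure RegularDistributor (A B : RegularQSemicategory Q) extends
    Distributor A.toQSemicategory B.toQSemicategory where
  homs_comp : (Distributor.homs A.toQSemicategory).comp toDistributor = toDistributor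
  comp_homs : toDistributor.comp (Distributor.homs B.toQSemicategory) = toDistributor

theorem RegularDistributor.ext_dist {A B : RegularQSemicategory Q} {Φ Ψ : RegularDistributor A B}
    (h : Φ.toDistributor = Ψ.toDistributor) : Φ = Ψ := by
  cases Φ
  cases Ψ
  cases h
  rfl

theorem RegularQSemicategory.homs_comp_homs (A : RegularQSemicategory Q) :
    (Distributor.homs A.toQSemicategory).comp (Distributor.homs A.toQSemicategory) =
      Distributor.homs A.toQSemicategory := by
  refine Distributor.ext ?_
  funext X Y c a
  exact A.regular a c

variable (Q) in
/-- The objects of `RSDist(Q)`: the regular `Q`-semicategories. -/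
abbrev RSDistCat : Type (u + 1) := RegularQSemicategory Q

instance : Category.{u} (RSDistCat Q) where
  Hom A B := RegularDistributor (Q := Q) A B
  id A :=
    { toDistributor := Distributor.homs (RegularQSemicategory.toQSemicategory A)
      homs_comp := RegularQSemicategory.homs_comp_homs A
      comp_homs := RegularQSemicategory.homs_comp_homs A }
  comp Φ Ψ :=
    { toDistributor := Φ.toDistributor.comp Ψ.toDistributor
      homs_comp := by rw [← Distributor.comp_assoc, Φ.homs_comp]
      comp_homs := by rw [Distributor.comp_assoc, Ψ.comp_homs] }
  id_comp Φ := RegularDistributor.ext_dist Φ.homs_comp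
  comp_id Φ := RegularDistributor.ext_dist Φ.comp_homs
  assoc Φ Ψ Χ := RegularDistributor.ext_dist (Distributor.comp_assoc _ _ _)

instance (A B : RSDistCat Q) : PartialOrder (A ⟶ B) :=
  PartialOrder.lift (fun Φ : RegularDistributor (Q := Q) A B => Φ.toDistributor)
    fun _ _ => RegularDistributor.ext_dist

/-- `RSDist(Q)`: regular `Q`-semicategories, regular semidistributors, and the elementwise
order. -/
instance : Bicategory.{u, u} (RSDistCat Q) :=
  locallyOrderedBicategory (B := RSDistCat Q) fun {_ _ _ Φ Φ₁ Ψ Ψ₁} h k =>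
    Distributor.comp_mono (Φ := Φ.toDistributor) (Φ₁ := Φ₁.toDistributor)
      (Ψ := Ψ.toDistributor) (Ψ₁ := Ψ₁.toDistributor) h k

/-! ### Cocomplete categories and cocontinuous functors -/

variable (Q) in
/-- The objects of `Cocont(Q)`: the cocomplete `Q`-categories. -/
structure Cocont : Type (u + 1) where
  /-- The underlying `Q`-category. -/
  cat : QCategory Q
  cocomplete : IsCocomplete cat

/-- A cocontinuous functor between cocomplete `Q`-categories. -/
@[ext]
structure CocontFunctor (A B : Cocont Q) where
  /-- The underlying functor. -/
  functor : QFunctor A.cat B.cat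
  cocontinuous : IsCocontinuous functor

instance (A B : Cocont Q) : Preorder (CocontFunctor A B) :=
  Preorder.lift CocontFunctor.functor

instance : Category.{u} (Cocont Q) where
  Hom A B := CocontFunctor A B
  id A :=
    { functor := QFunctor.id A.cat
      cocontinuous := fun _ _ _ _ _ h => h }
  comp F G :=
    { functor := F.functor.comp G.functor
      cocontinuous := fun X C Φ H K h =>
        G.cocontinuous X C Φ _ _ (F.cocontinuous X C Φ H K h) }

instance (A B : Cocont Q) : Preorder (A ⟶ B) := inferInstanceAs (Preorder (CocontFunctor A B))

/-- `Cocont(Q)`: cocomplete `Q`-categories, cocontinuous functors, and the local order of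
functors. -/
instance : Bicategory.{u, u} (Cocont Q) :=
  locallyOrderedBicategory fun h k => QFunctor.comp_mono h k

instance {A B : Cocont Q} (F G : A ⟶ B) : Subsingleton (F ⟶ G) := Preorder.subsingleton_hom F G

instance {A B : RSDistCat Q} (Φ Ψ : A ⟶ B) : Subsingleton (Φ ⟶ Ψ) := Preorder.subsingleton_hom Φ Ψ

/-! ### Cocompleteness of presheaf categories and the action of distributors -/

theorem Presheaf.one_le_hom {A : QSemicategory Q} {X : Q} {φ ψ : Presheaf A X} :
    𝟙 X ≤ (presheafCategory A).hom φ ψ ↔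
      ∀ (Y : Q) (a : A.obj Y), φ.app a ≤ ψ.app a := by
  simp only [le_iInf_iff, le_rightLift, Category.id_comp]

theorem Presheaf.eq_of_one_le {A : QSemicategory Q} {X : Q} {φ ψ : Presheaf A X}
    (h : 𝟙 X ≤ (presheafCategory A).hom φ ψ) (k : 𝟙 X ≤ (presheafCategory A).hom ψ φ) :
    φ = ψ := by
  refine Presheaf.ext ?_
  funext Y a
  exact le_antisymm (Presheaf.one_le_hom.1 h Y a) (Presheaf.one_le_hom.1 k Y a)

/-- The presheaf `Φ ⊗ φ`, with elements `⋁_a Φ(b, a) ∘ φ(a)`. -/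
def Presheaf.map {A B : QSemicategory Q} (Φ : Distributor A B) {X : Q} (φ : Presheaf A X) :
    Presheaf B X where
  app b := ⨆ (Y : Q) (a : A.obj Y), φ.app a ≫ Φ.app b a
  app_hom_le b c := by
    simp only [iSup_comp, Category.assoc]
    exact iSup₂_mono fun Y a => comp_le_comp_left _ (Φ.app_hom_le a b c)

theorem Presheaf.map_map {A B C : QSemicategory Q} (Φ : Distributor A B) (Ψ : Distributor B C)
    {X : Q} (φ : Presheaf A X) : (φ.map Φ).map Ψ = φ.map (Φ.comp Ψ) := by
  refine Presheaf.ext ?_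
  funext Y c
  simp only [Presheaf.map, Distributor.comp, iSup_comp, comp_iSup, Category.assoc]
  apply le_antisymm
  · exact iSup₂_le fun Z b => iSup₂_le fun W a =>
      le_iSup₂_of_le W a (le_iSup₂_of_le Z b le_rfl)
  · exact iSup₂_le fun Z b => iSup₂_le fun W a =>
      le_iSup₂_of_le W a (le_iSup₂_of_le Z b le_rfl)

theorem Presheaf.isRegular_iff {A : QSemicategory Q} {X : Q} (φ : Presheaf A X) :
    φ.IsRegular ↔ φ.map (Distributor.homs A) = φ := by
  constructor
  · intro h
    refine Presheaf.ext ?_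
    funext Z b
    exact h b
  · intro h Z b
    exact congrArg (fun ψ : Presheaf A X => ψ.app b) h

theorem Presheaf.isRegular_of_category (A : QCategory Q) {X : Q}
    (φ : Presheaf A.toQSemicategory X) : φ.IsRegular := by
  intro Z b
  refine le_antisymm (iSup₂_le fun Y a => φ.app_hom_le a b) (le_iSup₂_of_le Z b ?_)
  have h := comp_le_comp_left (φ.app b) (A.id_le b)
  rwa [Category.comp_id] at h

theorem Presheaf.hom_le_hom_map {A B : QSemicategory Q} (Φ : Distributor A B) {X Y : Q}
    (ψ : Presheaf A Y) (φ : Presheaf A X) :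
    (presheafCategory A).hom ψ φ ≤ (presheafCategory B).hom (ψ.map Φ) (φ.map Φ) := by
  refine le_iInf₂ fun Z b => le_rightLift.2 ?_
  simp only [Presheaf.map, comp_iSup, ← Category.assoc]
  exact iSup₂_mono fun W a => comp_le_comp_right (le_rightLift.1 (iInf₂_le W a)) _

/-- The pointwise supremum `⋁_c F(c) ∘ Θ(c, x)` of presheaves. -/
def Presheaf.weightedSup {C : QCategory Q} {A : QSemicategory Q}
    (F : ∀ {W : Q}, C.obj W → Presheaf A W) {Y : Q} (w : Presheaf C.toQSemicategory Y) :
    Presheaf A Y where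
  app a := ⨆ (W : Q) (c : C.obj W), w.app c ≫ (F c).app a
  app_hom_le a b := by
    simp only [iSup_comp, Category.assoc]
    exact iSup₂_mono fun W c => comp_le_comp_left _ ((F c).app_hom_le a b)

theorem Presheaf.weightedSup_map {C : QCategory Q} {A B : QSemicategory Q}
    (F : ∀ {W : Q}, C.obj W → Presheaf A W) {Y : Q} (w : Presheaf C.toQSemicategory Y)
    (Φ : Distributor A B) :
    (Presheaf.weightedSup F w).map Φ = Presheaf.weightedSup (fun c => (F c).map Φ) w := by
  refine Presheaf.ext ?_
  funext Z b
  simp only [Presheaf.map, Presheaf.weightedSup, iSup_comp, comp_iSup, Category.assoc]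
  apply le_antisymm
  · exact iSup₂_le fun Z b => iSup₂_le fun W a =>
      le_iSup₂_of_le W a (le_iSup₂_of_le Z b le_rfl)
  · exact iSup₂_le fun Z b => iSup₂_le fun W a =>
      le_iSup₂_of_le W a (le_iSup₂_of_le Z b le_rfl)

theorem Presheaf.hom_weightedSup {C : QCategory Q} {A : QSemicategory Q}
    (F : ∀ {W : Q}, C.obj W → Presheaf A W) {Y Z : Q} (w : Presheaf C.toQSemicategory Y)
    (φ : Presheaf A Z) :
    (presheafCategory A).hom (Presheaf.weightedSup F w) φ =
      ⨅ (W : Q) (c : C.obj W), rightLift (w.app c) ((presheafCategory A).hom (F c) φ) := by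
  refine eq_of_forall_le_iff fun f => ?_
  simp only [Presheaf.weightedSup, le_iInf_iff, le_rightLift, comp_iSup,
    iSup_le_iff, Category.assoc]
  exact ⟨fun h W c X a => h X a W c, fun h X a W c => h W c X a⟩

/-- The weighted colimit of a functor into a presheaf category, computed pointwise. -/
def presheafColimit {X C : QCategory Q} (A : QSemicategory Q)
    (Θ : Distributor X.toQSemicategory C.toQSemicategory)
    (F : QFunctor C (presheafCategory A)) : QFunctor X (presheafCategory A) where
  obj x := Presheaf.weightedSup (fun c => F.obj c) (Θ.toFunctor.obj x)
  hom_le y x := by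
    rw [Presheaf.hom_weightedSup]
    refine le_iInf₂ fun W c => le_rightLift.2 ((Θ.hom_app_le x y c).trans ?_)
    refine le_iInf₂ fun Z a => le_rightLift.2 ?_
    exact le_iSup₂_of_le W c le_rfl

theorem isColimit_presheafColimit {X C : QCategory Q} (A : QSemicategory Q)
    (Θ : Distributor X.toQSemicategory C.toQSemicategory)
    (F : QFunctor C (presheafCategory A)) : IsColimit Θ F (presheafColimit A Θ F) :=
  fun _ _ x φ => Presheaf.hom_weightedSup (fun c => F.obj c) (Θ.toFunctor.obj x) φ

/-- The inclusion of regular presheaves into presheaves. -/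
def regularInclusion (A : QSemicategory Q) :
    QFunctor (regularPresheafCategory A) (presheafCategory A) where
  obj φ := φ.1
  hom_le _ _ := le_rfl

/-- The weighted colimit of a functor into a category of regular presheaves, computed
pointwise. -/
def regularColimit {X C : QCategory Q} (A : QSemicategory Q)
    (Θ : Distributor X.toQSemicategory C.toQSemicategory)
    (F : QFunctor C (regularPresheafCategory A)) : QFunctor X (regularPresheafCategory A) where
  obj x := ⟨(presheafColimit A Θ (F.comp (regularInclusion A))).obj x, by
    rw [Presheaf.isRegular_iff]
    refine (Presheaf.weightedSup_map _ _ _).trans ?_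
    refine congrArg (fun G : (∀ {W : Q}, C.obj W → Presheaf A W) =>
      Presheaf.weightedSup G (Θ.toFunctor.obj x)) ?_
    funext W c
    exact (Presheaf.isRegular_iff _).1 (F.obj c).2⟩
  hom_le y x := (presheafColimit A Θ (F.comp (regularInclusion A))).hom_le y x

theorem isColimit_regularColimit {X C : QCategory Q} (A : QSemicategory Q)
    (Θ : Distributor X.toQSemicategory C.toQSemicategory)
    (F : QFunctor C (regularPresheafCategory A)) : IsColimit Θ F (regularColimit A Θ F) :=
  fun _ _ x φ => isColimit_presheafColimit A Θ (F.comp (regularInclusion A)) x φ.1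

theorem IsColimit.iso {X C A : QCategory Q}
    {Φ : Distributor X.toQSemicategory C.toQSemicategory} {F : QFunctor C A}
    {K L : QFunctor X A} (hK : IsColimit Φ F K) (hL : IsColimit Φ F L) : K.Iso L :=
  ⟨fun _ x => by rw [hK x, ← hL x]; exact A.id_le _,
    fun _ x => by rw [hL x, ← hK x]; exact A.id_le _⟩

theorem isCocomplete_presheafCategory (A : QSemicategory Q) :
    IsCocomplete (presheafCategory A) :=
  fun _ _ Φ F => ⟨_, isColimit_presheafColimit A Φ F⟩

theorem isCocomplete_regularPresheafCategory (A : QSemicategory Q) :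
    IsCocomplete (regularPresheafCategory A) :=
  fun _ _ Φ F => ⟨_, isColimit_regularColimit A Φ F⟩

/-- The functor `Φ ⊗ - : P A ⟶ P B`. -/
def presheafMap {A B : QSemicategory Q} (Φ : Distributor A B) :
    QFunctor (presheafCategory A) (presheafCategory B) where
  obj φ := φ.map Φ
  hom_le := Presheaf.hom_le_hom_map Φ

theorem isCocontinuous_presheafMap {A B : QSemicategory Q} (Φ : Distributor A B) :
    IsCocontinuous (presheafMap Φ) := by
  intro X C Θ F K hK
  have key : K.comp (presheafMap Φ) = presheafColimit B Θ (F.comp (presheafMap Φ)) := by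
    refine QFunctor.ext ?_
    funext Y x
    have h := hK.iso (isColimit_presheafColimit A Θ F)
    have e : K.obj x = (presheafColimit A Θ F).obj x :=
      Presheaf.eq_of_one_le (h.1 x) (h.2 x)
    change (K.obj x).map Φ = _
    rw [e]
    exact Presheaf.weightedSup_map (fun c => F.obj c) (Θ.toFunctor.obj x) Φ
  rw [key]
  exact isColimit_presheafColimit B Θ (F.comp (presheafMap Φ))

/-- The functor `Φ ⊗ - : R A ⟶ R B`, for a regular semidistributor `Φ`. -/
def regularMap {A B : RegularQSemicategory Q} (Φ : RegularDistributor A B) :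
    QFunctor (regularPresheafCategory A.toQSemicategory)
      (regularPresheafCategory B.toQSemicategory) where
  obj φ := ⟨φ.1.map Φ.toDistributor, by
    rw [Presheaf.isRegular_iff, Presheaf.map_map, Φ.comp_homs]⟩
  hom_le ψ φ := Presheaf.hom_le_hom_map Φ.toDistributor ψ.1 φ.1

theorem isCocontinuous_regularMap {A B : RegularQSemicategory Q} (Φ : RegularDistributor A B) :
    IsCocontinuous (regularMap Φ) := by
  intro X C Θ F K hK
  have key : K.comp (regularMap Φ) =
      regularColimit B.toQSemicategory Θ (F.comp (regularMap Φ)) := by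
    refine QFunctor.ext ?_
    funext Y x
    have h := hK.iso (isColimit_regularColimit A.toQSemicategory Θ F)
    have e : (K.obj x).1 = ((regularColimit A.toQSemicategory Θ F).obj x).1 :=
      Presheaf.eq_of_one_le (h.1 x) (h.2 x)
    refine Subtype.ext ?_
    change (K.obj x).1.map Φ.toDistributor = _
    rw [e]
    exact Presheaf.weightedSup_map (fun c => (F.obj c).1) (Θ.toFunctor.obj x) Φ.toDistributor
  rw [key]
  exact isColimit_regularColimit B.toQSemicategory Θ (F.comp (regularMap Φ))

theorem Presheaf.map_mono {A B : QSemicategory Q} {Φ Ψ : Distributor A B} (h : Φ ≤ Ψ) {X : Q}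
    (φ : Presheaf A X) : 𝟙 X ≤ (presheafCategory B).hom (φ.map Φ) (φ.map Ψ) :=
  Presheaf.one_le_hom.2 fun _ b => iSup₂_mono fun _ a => comp_le_comp_left _ (h b a)

/-! ### The 2-functors `P`, `R` and the inclusion of `Dist(Q)` in `RSDist(Q)` -/

variable (Q) in
/-- The 2-functor `Dist(Q) ⟶ Cocont(Q)` sending `A` to `P A` and `Φ` to `Φ ⊗ -`. -/
def presheafPseudofunctor : DistCat Q ⥤ᵖ Cocont Q where
  obj A :=
    { cat := presheafCategory (QCategory.toQSemicategory A)
      cocomplete := isCocomplete_presheafCategory _ }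
  map Φ :=
    { functor := presheafMap Φ
      cocontinuous := isCocontinuous_presheafMap Φ }
  map₂ η := homOfLE fun _ φ => Presheaf.map_mono (leOfHom η) φ
  mapId A := eqToIso (CocontFunctor.ext (QFunctor.ext (by
    funext X φ
    exact (Presheaf.isRegular_iff _).1 (Presheaf.isRegular_of_category A φ))))
  mapComp Φ Ψ := eqToIso (CocontFunctor.ext (QFunctor.ext (by
    funext X φ
    exact (Presheaf.map_map Φ Ψ φ).symm)))
  map₂_id _ := Subsingleton.elim _ _
  map₂_comp _ _ := Subsingleton.elim _ _
  map₂_whisker_left _ _ _ _ := Subsingleton.elim _ _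
  map₂_whisker_right _ _ := Subsingleton.elim _ _
  map₂_associator _ _ _ := Subsingleton.elim _ _
  map₂_left_unitor _ := Subsingleton.elim _ _
  map₂_right_unitor _ := Subsingleton.elim _ _

variable (Q) in
/-- The 2-functor `RSDist(Q) ⟶ Cocont(Q)` sending `B` to `R B` and `Φ` to `Φ ⊗ -`. -/
def regularPseudofunctor : RSDistCat Q ⥤ᵖ Cocont Q where
  obj A :=
    { cat := regularPresheafCategory (RegularQSemicategory.toQSemicategory A)
      cocomplete := isCocomplete_regularPresheafCategory _ }
  map Φ :=
    { functor := regularMap Φ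
      cocontinuous := isCocontinuous_regularMap Φ }
  map₂ η := homOfLE fun _ φ => Presheaf.map_mono (leOfHom η) φ.1
  mapId A := eqToIso (CocontFunctor.ext (QFunctor.ext (by
    funext X φ
    exact Subtype.ext ((Presheaf.isRegular_iff _).1 φ.2))))
  mapComp Φ Ψ := eqToIso (CocontFunctor.ext (QFunctor.ext (by
    funext X φ
    exact Subtype.ext (Presheaf.map_map Φ.toDistributor Ψ.toDistributor φ.1).symm)))
  map₂_id _ := Subsingleton.elim _ _
  map₂_comp _ _ := Subsingleton.elim _ _
  map₂_whisker_left _ _ _ _ := Subsingleton.elim _ _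
  map₂_whisker_right _ _ := Subsingleton.elim _ _
  map₂_associator _ _ _ := Subsingleton.elim _ _
  map₂_left_unitor _ := Subsingleton.elim _ _
  map₂_right_unitor _ := Subsingleton.elim _ _

/-- A `Q`-category, regarded as a regular `Q`-semicategory. -/
def QCategory.toRegular (A : QCategory Q) : RegularQSemicategory Q where
  toQSemicategory := A.toQSemicategory
  regular a c := congrArg (fun Φ : Distributor A.toQSemicategory A.toQSemicategory => Φ.app c a)
    (Distributor.homs_comp A (Distributor.homs A.toQSemicategory))

variable (Q) in
/-- The inclusion `Dist(Q) ⟶ RSDist(Q)`. -/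
def distInclusion : DistCat Q ⥤ᵖ RSDistCat Q where
  obj A := QCategory.toRegular A
  map {A B} Φ :=
    { toDistributor := Φ
      homs_comp := Distributor.homs_comp A Φ
      comp_homs := Distributor.comp_homs B Φ }
  map₂ η := homOfLE (leOfHom η)
  mapId _ := Iso.refl _
  mapComp _ _ := Iso.refl _
  map₂_id _ := Subsingleton.elim _ _
  map₂_comp _ _ := Subsingleton.elim _ _
  map₂_whisker_left _ _ _ _ := Subsingleton.elim _ _
  map₂_whisker_right _ _ := Subsingleton.elim _ _
  map₂_associator _ _ _ := Subsingleton.elim _ _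
  map₂_left_unitor _ := Subsingleton.elim _ _
  map₂_right_unitor _ := Subsingleton.elim _ _

/-- For a `Q`-category `A`, the identification `P A ⟶ R A`, `φ ↦ φ`: every presheaf on `A` is
regular. -/
def presheafToRegular (A : QCategory Q) :
    QFunctor (presheafCategory A.toQSemicategory) (regularPresheafCategory A.toQSemicategory) where
  obj φ := ⟨φ, Presheaf.isRegular_of_category A φ⟩
  hom_le _ _ := le_rfl

/-- The identification `P A ⟶ R A` is cocontinuous, i.e. an arrow of `Cocont(Q)`. -/
theorem isCocontinuous_presheafToRegular (A : QCategory Q) :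
    IsCocontinuous (presheafToRegular A) :=
  fun _ _ _ _ _ h _ _ x φ => h x φ.1

/-! ### Suprema, total-belowness, and the properties of cocomplete categories -/

/-- The supremum functor `sup_A : P A ⟶ A`, `φ ↦ colim(φ, 1_A)`: it is the (pointwise) left Kan
extension of `1_A` along the Yoneda embedding `Y`, i.e. the colimit of `1_A` weighted by the
distributor `P A(Y-, -) : P A ⇸ A`. -/
noncomputable def supFunctor (A : Cocont Q) :
    QFunctor (presheafCategory A.cat.toQSemicategory) A.cat :=
  (A.cocomplete _ _ (yonedaFunctor A.cat).cograph (QFunctor.id A.cat)).choose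

/-- `A` is completely distributive: `sup_A` has a left adjoint in `Cat(Q)`. -/
def IsCompletelyDistributive (A : Cocont Q) : Prop :=
  ∃ L : QFunctor A.cat (presheafCategory A.cat.toQSemicategory), L.Adjoint (supFunctor A)

/-- The totally-below relation `Θ_A : A ⇸ A`: the right extension of `P A(Y-, -) : P A ⇸ A`
through `A(-, sup_A -) : P A ⇸ A`. -/
noncomputable def totallyBelow (A : Cocont Q) :
    Distributor A.cat.toQSemicategory A.cat.toQSemicategory :=
  (supFunctor A).graph.rightExtension (yonedaFunctor A.cat).cograph

/-- `A` is totally continuous: `sup_A ∘ T_A ≅ 1_A`, where `T_A(a) = Θ_A(-, a)`; that is, every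
object is the supremum of the objects totally below it. -/
def IsTotallyContinuous (A : Cocont Q) : Prop :=
  ((totallyBelow A).toFunctor.comp (supFunctor A)).Iso (QFunctor.id A.cat)

/-- An object `a` is totally compact if `1_{ta} ≤ Θ_A(a, a)`. -/
def IsTotallyCompact (A : Cocont Q) {X : Q} (a : A.cat.obj X) : Prop :=
  𝟙 X ≤ (totallyBelow A).app a a

/-- The full subcategory of totally compact objects. -/
def compactObjects (A : Cocont Q) : QCategory Q where
  obj X := {a : A.cat.obj X // IsTotallyCompact A a}
  hom b a := A.cat.hom b.1 a.1
  comp_le _ _ _ := A.cat.comp_le _ _ _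
  id_le _ := A.cat.id_le _

/-- The full embedding of the totally compact objects. -/
def compactInclusion (A : Cocont Q) : QFunctor (compactObjects A) A.cat where
  obj a := a.1
  hom_le _ _ := le_rfl

/-- The distributor `Σ_A = A(-, i-) ⊗ A(i-, -)`, for `i` the embedding of the totally compact
objects. -/
def compactBelow (A : Cocont Q) : Distributor A.cat.toQSemicategory A.cat.toQSemicategory :=
  (compactInclusion A).cograph.comp (compactInclusion A).graph

/-- `A` is totally algebraic: `sup_A ∘ S_A ≅ 1_A`, where `S_A(a) = Σ_A(-, a)`; that is, every
object is the supremum of the totally compact objects below it. -/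
def IsTotallyAlgebraic (A : Cocont Q) : Prop :=
  ((compactBelow A).toFunctor.comp (supFunctor A)).Iso (QFunctor.id A.cat)

/-! ### Notions in a bicategory -/

section Bicategory

universe w₁ w₂ v₁ v₂ u₁ u₂

variable {B : Type u₁} [Bicategory.{w₁, v₁} B] {C : Type u₂} [Bicategory.{w₂, v₂} C]

/-- Epimorphisms, up to isomorphism of 1-cells: `g ∘ f ≅ h ∘ f` implies `g ≅ h`. -/
def IsEpimorphism {a b : B} (f : a ⟶ b) : Prop :=
  ∀ (c : B) (g h : b ⟶ c), Nonempty (f ≫ g ≅ f ≫ h) → Nonempty (g ≅ h)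

/-- Projective objects: every arrow out of `a` factors, up to isomorphism, through every
epimorphism into its codomain. -/
def IsProjective (a : B) : Prop :=
  ∀ (b c : B) (f : a ⟶ b) (g : c ⟶ b), IsEpimorphism g →
    ∃ h : a ⟶ c, Nonempty (h ≫ g ≅ f)

/-- A biequivalence: a pseudofunctor that is locally an equivalence of categories, and
surjective on objects up to equivalence. -/
def IsBiequivalence (F : B ⥤ᵖ C) : Prop :=
  (∀ a b : B, (F.mapFunctor a b).IsEquivalence) ∧ ∀ c : C, ∃ b : B, Nonempty (F.obj b ≌ c)

/-- A full 2-inclusion: injective on objects, bijective on 1-cells, and locally fully faithful. -/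
def IsFullInclusion (F : B ⥤ᵖ C) : Prop :=
  Function.Injective F.obj ∧
    ∀ a b : B, Function.Bijective (fun f : a ⟶ b => F.map f) ∧
      (F.mapFunctor a b).Full ∧ (F.mapFunctor a b).Faithful

/-- The full sub-bicategory on the objects satisfying `P`. -/
abbrev FullSub (P : C → Prop) := InducedBicategory C (Subtype.val : {c : C // P c} → C)

/-- The corestriction of a pseudofunctor to a full sub-bicategory that contains its values. -/
def corestrict (F : B ⥤ᵖ C) (P : C → Prop) (h : ∀ b, P (F.obj b)) : B ⥤ᵖ FullSub P where
  obj b := (⟨F.obj b, h b⟩ : {c : C // P c})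
  map f := InducedBicategory.mkHom (F.map f)
  map₂ η := InducedBicategory.mkHom₂ (F.map₂ η)
  mapId b := InducedBicategory.isoMk (F.mapId b)
  mapComp f g := InducedBicategory.isoMk (F.mapComp f g)

/-- The inclusion of full sub-bicategories determined by an implication of properties. -/
def fullSubInclusion {P P₁ : C → Prop} (h : ∀ c, P c → P₁ c) : FullSub P ⥤ᵖ FullSub P₁ :=
  corestrict InducedBicategory.forget.toPseudofunctor P₁
    (fun c : {c : C // P c} => h c.1 c.2)

end Bicategory

variable (Q) in
/-- `Cocont_tc(Q)`: the totally continuous cocomplete `Q`-categories. -/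
abbrev CocontTC := FullSub (IsTotallyContinuous (Q := Q))

variable (Q) in
/-- `Cocont_ta(Q)`: the totally algebraic cocomplete `Q`-categories. -/
abbrev CocontTA := FullSub (IsTotallyAlgebraic (Q := Q))

end QEnriched

open QEnriched
open scoped CategoryTheory.Pseudofunctor.StrongTrans

/-! Colimits are handled elementwise: an object is the supremum of a family of objects weighted by
arrows, and the family need not be indexed by a category. A cocontinuous functor on a cocomplete
category has a right adjoint, so it preserves all such suprema. In presheaf categories, regular or
not, they are computed pointwise.

Total continuity says exactly that a ↦ Θ(-, a) is left adjoint to sup: the inequality Θ(-, sup φ) ≤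
φ always holds, and any left adjoint L satisfies L a ≤ Θ(-, a). This gives the equivalence with
complete distributivity. If A is projective, then sup : P A → A, an epimorphism because Yoneda
splits it as a functor, has a cocontinuous section, and such a section is automatically left adjoint
to sup. Conversely, an epimorphism G : C → B of Cocont(Q) with right adjoint H satisfies G H b ≅ b
(`IsEpimorphism.one_le`). A cocontinuous F : A → B then lifts to a ↦ ⋁_d Θ(d, a) · H F d, since a =
⋁_d Θ(d, a) · d.

Applying the cocontinuous functor Θ to this last supremum gives Θ = Θ ⊗ Θ. The objects of A with Θ
as hom thus form a regular semicategory B, and Θ(-, a) and sup are inverse equivalences between A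
and R B. In the other direction, a regular presheaf is the supremum of the representables weighted
by its values, and these lie totally below it. The algebraic case has the same shape: totally
compact objects correspond to representables, and the Yoneda lemma becomes an equality.

The biequivalences follow because a cocontinuous functor between categories of (regular) presheaves
is determined by its values on representables, which form a (regular semi)distributor. -/

namespace QEnriched

/-! ### Weighted suprema, the supremum functor, and equivalences in Cocont(Q). -/

section Basic

variable {Q : Type u} [Quantaloid Q]

namespace QCategory

variable (A : QCategory Q)

theorem comp_le_hom {X Y Z : Q} {a : A.obj X} {b : A.obj Y} {c : A.obj Z} {f : X ⟶ Y} {g : Y ⟶ Z}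
    (hf : f ≤ A.hom b a) (hg : g ≤ A.hom c b) : f ≫ g ≤ A.hom c a :=
  ((comp_le_comp_right hf g).trans (comp_le_comp_left _ hg)).trans (A.comp_le _ _ _)

theorem le_comp_hom {X Y : Q} (f : X ⟶ Y) (a : A.obj Y) : f ≤ f ≫ A.hom a a := by
  simpa using comp_le_comp_left f (A.id_le a)

variable {A}

theorem hom_mono_right {X Y : Q} {a b : A.obj X} (h : 𝟙 X ≤ A.hom a b) (c : A.obj Y) :
    A.hom c a ≤ A.hom c b := by
  simpa using A.comp_le_hom h (le_refl (A.hom c a))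

theorem hom_mono_left {X Y : Q} {a b : A.obj X} (h : 𝟙 X ≤ A.hom a b) (c : A.obj Y) :
    A.hom b c ≤ A.hom a c := by
  simpa using A.comp_le_hom (le_refl (A.hom b c)) h

theorem one_le_trans {X : Q} {a b c : A.obj X} (h : 𝟙 X ≤ A.hom a b) (k : 𝟙 X ≤ A.hom b c) :
    𝟙 X ≤ A.hom a c :=
  h.trans (hom_mono_right k a)

end QCategory

theorem le_presheafCategory_hom {A : QSemicategory Q} {X Y : Q} {ψ : Presheaf A Y}
    {φ : Presheaf A X} {f : X ⟶ Y} :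
    f ≤ (presheafCategory A).hom ψ φ ↔ ∀ (W : Q) (a : A.obj W), f ≫ ψ.app a ≤ φ.app a := by
  simp only [le_iInf_iff, le_rightLift]

theorem yoneda_hom (A : QCategory Q) {X Y : Q} (a : A.obj Y) (φ : Presheaf A.toQSemicategory X) :
    (presheafCategory A.toQSemicategory).hom ((yonedaFunctor A).obj a) φ = φ.app a := by
  apply le_antisymm
  · exact (A.le_comp_hom _ a).trans (le_presheafCategory_hom.1
      (le_refl ((presheafCategory A.toQSemicategory).hom ((yonedaFunctor A).obj a) φ)) Y a)
  · exact le_presheafCategory_hom.2 fun W b => φ.app_hom_le a b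

/-! ### Weighted suprema of families of objects -/

/-- The object `a` is the supremum of the family `x` weighted by the arrows `w`:
`A(a, b) = ⋀_i [w(i), A(x(i), b)]` for all `b`. -/
def IsWeightedSup (A : QCategory Q) {ι : Q → Type u} {Y : Q} (x : ∀ {W : Q}, ι W → A.obj W)
    (w : ∀ {W : Q}, ι W → (Y ⟶ W)) (a : A.obj Y) : Prop :=
  ∀ ⦃Z : Q⦄ (b : A.obj Z) (f : Z ⟶ Y),
    f ≤ A.hom a b ↔ ∀ (W : Q) (i : ι W), f ≫ w i ≤ A.hom (x i) b

theorem isColimit_iff {X C A : QCategory Q}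
    {Φ : Distributor X.toQSemicategory C.toQSemicategory} {F : QFunctor C A} {K : QFunctor X A} :
    IsColimit Φ F K ↔ ∀ (Y : Q) (x : X.obj Y),
      IsWeightedSup A (fun c => F.obj c) (fun c => Φ.app c x) (K.obj x) := by
  constructor
  · intro h Y x Z b f
    rw [h x b]
    simp only [le_iInf_iff, le_rightLift]
  · intro h Y Z x a
    refine eq_of_forall_le_iff fun f => ?_
    rw [h Y x a f]
    simp only [le_iInf_iff, le_rightLift]

namespace IsWeightedSup

variable {A B : QCategory Q} {ι : Q → Type u} {Y : Q} {x : ∀ {W : Q}, ι W → A.obj W}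
  {w : ∀ {W : Q}, ι W → (Y ⟶ W)} {a b : A.obj Y}

theorem weight_le (h : IsWeightedSup A x w a) {W : Q} (i : ι W) : w i ≤ A.hom (x i) a := by
  simpa using (h a (𝟙 Y)).1 (A.id_le a) W i

theorem le_of (h : IsWeightedSup A x w a)
    (hb : ∀ (W : Q) (i : ι W), w i ≤ A.hom (x i) b) : 𝟙 Y ≤ A.hom a b :=
  (h b (𝟙 Y)).2 fun W i => by simpa using hb W i

theorem unique (h : IsWeightedSup A x w a) (k : IsWeightedSup A x w b) : 𝟙 Y ≤ A.hom a b :=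
  h.le_of fun _ i => k.weight_le i

theorem of_iso (h : IsWeightedSup A x w a) (hab : 𝟙 Y ≤ A.hom a b) (hba : 𝟙 Y ≤ A.hom b a) :
    IsWeightedSup A x w b := fun Z c f => by
  rw [← h c f, le_antisymm (QCategory.hom_mono_left hab c) (QCategory.hom_mono_left hba c)]

theorem map_of_homs (h : IsWeightedSup A x w a) (G : QFunctor A B)
    (H : ∀ {Z : Q}, B.obj Z → A.obj Z)
    (hG : ∀ {X Z : Q} (a : A.obj X) (b : B.obj Z), B.hom (G.obj a) b = A.hom a (H b)) :
    IsWeightedSup B (fun i => G.obj (x i)) w (G.obj a) := by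
  intro Z b f
  simp only [hG]
  exact h (H b) f

end IsWeightedSup

/-- Left adjoints preserve colimits; for this the right adjoint `H` is needed only as a map on
objects. -/
theorem isCocontinuous_of_homs {A B : QCategory Q} (G : QFunctor A B)
    (H : ∀ {Z : Q}, B.obj Z → A.obj Z)
    (hG : ∀ {X Z : Q} (a : A.obj X) (b : B.obj Z), B.hom (G.obj a) b = A.hom a (H b)) :
    IsCocontinuous G := fun _ _ _ _ _ hK =>
  isColimit_iff.2 fun Y x => (isColimit_iff.1 hK Y x).map_of_homs G H hG

theorem QFunctor.Adjoint.hom_eq {A B : QCategory Q} {F : QFunctor A B} {G : QFunctor B A}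
    (h : F.Adjoint G) {X Z : Q} (a : A.obj X) (b : B.obj Z) :
    B.hom (F.obj a) b = A.hom a (G.obj b) :=
  le_antisymm ((G.hom_le _ _).trans (QCategory.hom_mono_left (h.1 a) _))
    ((F.hom_le _ _).trans (QCategory.hom_mono_right (h.2 b) _))

theorem QFunctor.Adjoint.isCocontinuous {A B : QCategory Q} {F : QFunctor A B}
    {G : QFunctor B A} (h : F.Adjoint G) : IsCocontinuous F :=
  isCocontinuous_of_homs F (fun b => G.obj b) h.hom_eq

/-- A cocontinuous functor on a cocomplete category has a right adjoint. -/
theorem IsCocontinuous.exists_rightAdjoint {A B : QCategory Q} (hA : IsCocomplete A)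
    {G : QFunctor A B} (hG : IsCocontinuous G) :
    ∃ H : QFunctor B A, ∀ {X Z : Q} (a : A.obj X) (b : B.obj Z),
      B.hom (G.obj a) b = A.hom a (H.obj b) := by
  -- The right adjoint sends b to the supremum of all objects a weighted by B(G a, b). Since `G`
  -- preserves this supremum, G H b lies below b, which is the counit.
  obtain ⟨H, hH⟩ := hA B A G.cograph (QFunctor.id A)
  have h₁ := isColimit_iff.1 hH
  have h₂ := isColimit_iff.1 (hG _ _ _ _ _ hH)
  refine ⟨H, fun {X Z} a b => le_antisymm ((h₁ Z b).weight_le a) ((G.hom_le a (H.obj b)).trans ?_)⟩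
  refine QCategory.hom_mono_right ?_ _
  exact (h₂ Z b).le_of fun W c => le_rfl

/-- Cocontinuity speaks of colimits of functors, whereas here the family carries no functoriality.
The right adjoint bridges the gap. -/
theorem IsCocontinuous.map_isWeightedSup {A B : QCategory Q} (hA : IsCocomplete A)
    {G : QFunctor A B} (hG : IsCocontinuous G) {ι : Q → Type u} {Y : Q}
    {x : ∀ {W : Q}, ι W → A.obj W} {w : ∀ {W : Q}, ι W → (Y ⟶ W)} {a : A.obj Y}
    (h : IsWeightedSup A x w a) : IsWeightedSup B (fun i => G.obj (x i)) w (G.obj a) := by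
  obtain ⟨H, hH⟩ := hG.exists_rightAdjoint hA
  exact h.map_of_homs G (fun b => H.obj b) hH

/-! ### Weighted suprema of presheaves -/

/-- The pointwise weighted supremum of a family of presheaves. -/
def Presheaf.iSupWeighted {A : QSemicategory Q} {ι : Q → Type u} {Y : Q}
    (x : ∀ {W : Q}, ι W → Presheaf A W) (w : ∀ {W : Q}, ι W → (Y ⟶ W)) : Presheaf A Y where
  app a := ⨆ (W : Q) (i : ι W), w i ≫ (x i).app a
  app_hom_le a b := by
    simp only [iSup_comp, Category.assoc]
    exact iSup₂_mono fun W i => comp_le_comp_left _ ((x i).app_hom_le a b)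

theorem Presheaf.isWeightedSup_iSupWeighted {A : QSemicategory Q} {ι : Q → Type u} {Y : Q}
    (x : ∀ {W : Q}, ι W → Presheaf A W) (w : ∀ {W : Q}, ι W → (Y ⟶ W)) :
    IsWeightedSup (presheafCategory A) x w (Presheaf.iSupWeighted x w) := by
  intro Z φ f
  rw [le_presheafCategory_hom]
  simp only [Presheaf.iSupWeighted, comp_iSup, iSup_le_iff, le_iInf_iff, le_rightLift,
    Category.assoc]
  exact ⟨fun h W i V a => h V a W i, fun h V a W i => h W i V a⟩

theorem Presheaf.isRegular_iSupWeighted {A : QSemicategory Q} {ι : Q → Type u} {Y : Q}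
    {x : ∀ {W : Q}, ι W → Presheaf A W} (w : ∀ {W : Q}, ι W → (Y ⟶ W))
    (hx : ∀ {W : Q} (i : ι W), (x i).IsRegular) : (Presheaf.iSupWeighted x w).IsRegular := by
  intro Z b
  simp only [Presheaf.iSupWeighted, iSup_comp, Category.assoc]
  apply le_antisymm
  · exact iSup₂_le fun V a => iSup₂_le fun W i =>
      le_iSup₂_of_le W i (comp_le_comp_left _ ((x i).app_hom_le a b))
  · refine iSup₂_le fun W i => ?_
    rw [← hx i b]
    simp only [comp_iSup]
    exact iSup₂_le fun V a => le_iSup₂_of_le V a (le_iSup₂_of_le W i le_rfl)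

/-- A weighted supremum in a presheaf category is computed pointwise. -/
theorem IsWeightedSup.presheaf_app {A : QSemicategory Q} {ι : Q → Type u} {Y : Q}
    {x : ∀ {W : Q}, ι W → Presheaf A W} {w : ∀ {W : Q}, ι W → (Y ⟶ W)} {φ : Presheaf A Y}
    (h : IsWeightedSup (presheafCategory A) x w φ) {Z : Q} (a : A.obj Z) :
    φ.app a = ⨆ (W : Q) (i : ι W), w i ≫ (x i).app a := by
  have k := Presheaf.isWeightedSup_iSupWeighted x w
  rw [Presheaf.eq_of_one_le (h.unique k) (k.unique h)]
  rfl

/-- A weighted supremum in a category of regular presheaves is computed pointwise. -/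
theorem IsWeightedSup.regularPresheaf_app {A : QSemicategory Q} {ι : Q → Type u} {Y : Q}
    {x : ∀ {W : Q}, ι W → (regularPresheafCategory A).obj W} {w : ∀ {W : Q}, ι W → (Y ⟶ W)}
    {φ : (regularPresheafCategory A).obj Y}
    (h : IsWeightedSup (regularPresheafCategory A) x w φ) {Z : Q} (a : A.obj Z) :
    φ.1.app a = ⨆ (W : Q) (i : ι W), w i ≫ (x i).1.app a := by
  have k : IsWeightedSup (regularPresheafCategory A) x w
      ⟨Presheaf.iSupWeighted (fun i => (x i).1) w,
        Presheaf.isRegular_iSupWeighted w fun i => (x i).2⟩ :=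
    fun Z b f => Presheaf.isWeightedSup_iSupWeighted (fun i => (x i).1) w b.1 f
  rw [Presheaf.eq_of_one_le (h.unique k) (k.unique h)]
  rfl

/-- Every presheaf is the supremum of the representables it contains. -/
theorem Presheaf.isWeightedSup_yoneda (A : QCategory Q) {X : Q}
    (φ : Presheaf A.toQSemicategory X) :
    IsWeightedSup (presheafCategory A.toQSemicategory) (fun a => (yonedaFunctor A).obj a)
      (fun a => φ.app a) φ := by
  intro Z ψ f
  rw [le_presheafCategory_hom]
  exact forall₂_congr fun W a => by rw [yoneda_hom]

/-! ### The supremum functor -/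

section Sup

variable (A : Cocont Q)

/-- The weight in the definition of sup is P A(Y-, φ), which the Yoneda lemma turns into φ itself.
-/
theorem isWeightedSup_sup {X : Q} (φ : Presheaf A.cat.toQSemicategory X) :
    IsWeightedSup A.cat (fun a => a) (fun a => φ.app a) ((supFunctor A).obj φ) := by
  have h := isColimit_iff.1
    (A.cocomplete _ _ (yonedaFunctor A.cat).cograph (QFunctor.id A.cat)).choose_spec X φ
  intro Z b f
  refine (h b f).trans ?_
  refine forall₂_congr fun W c => ?_
  change f ≫ (presheafCategory A.cat.toQSemicategory).hom ((yonedaFunctor A.cat).obj c) φ ≤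
    A.cat.hom c b ↔ f ≫ φ.app c ≤ A.cat.hom c b
  rw [yoneda_hom]

/-- The adjunction of sup with the Yoneda embedding, in terms of homs. -/
theorem hom_sup_eq {X Z : Q} (φ : Presheaf A.cat.toQSemicategory X) (b : A.cat.obj Z) :
    A.cat.hom ((supFunctor A).obj φ) b =
      (presheafCategory A.cat.toQSemicategory).hom φ ((yonedaFunctor A.cat).obj b) :=
  eq_of_forall_le_iff fun f => by
    rw [isWeightedSup_sup A φ b f, le_presheafCategory_hom]
    rfl

theorem isCocontinuous_supFunctor : IsCocontinuous (supFunctor A) :=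
  isCocontinuous_of_homs _ (fun b => (yonedaFunctor A.cat).obj b) (hom_sup_eq A)

theorem le_sup_yoneda {X : Q} (a : A.cat.obj X) :
    𝟙 X ≤ A.cat.hom a ((supFunctor A).obj ((yonedaFunctor A.cat).obj a)) :=
  (A.cat.id_le a).trans
    ((isWeightedSup_sup A ((yonedaFunctor A.cat).obj a)).weight_le a)

theorem sup_yoneda_le {X : Q} (a : A.cat.obj X) :
    𝟙 X ≤ A.cat.hom ((supFunctor A).obj ((yonedaFunctor A.cat).obj a)) a :=
  (isWeightedSup_sup A _).le_of fun _ _ => le_rfl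

theorem sup_mono {X : Q} {φ ψ : Presheaf A.cat.toQSemicategory X}
    (h : ∀ (W : Q) (a : A.cat.obj W), φ.app a ≤ ψ.app a) :
    𝟙 X ≤ A.cat.hom ((supFunctor A).obj φ) ((supFunctor A).obj ψ) :=
  (Presheaf.one_le_hom.2 h).trans ((supFunctor A).hom_le _ _)

theorem sup_le_of_le_hom {X : Q} {φ : Presheaf A.cat.toQSemicategory X} {a : A.cat.obj X}
    (h : ∀ (W : Q) (b : A.cat.obj W), φ.app b ≤ A.cat.hom b a) :
    𝟙 X ≤ A.cat.hom ((supFunctor A).obj φ) a :=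
  (isWeightedSup_sup A φ).le_of h

end Sup

/-! ### Arrows and equivalences of `Cocont(Q)` -/

theorem nonempty_iso_iff {A B : Cocont Q} {F G : A ⟶ B} :
    Nonempty (F ≅ G) ↔ F.functor.Iso G.functor :=
  ⟨fun ⟨e⟩ => ⟨leOfHom e.hom, leOfHom e.inv⟩,
    fun h => ⟨⟨homOfLE h.1, homOfLE h.2, Subsingleton.elim _ _, Subsingleton.elim _ _⟩⟩⟩

/-- Cocontinuity comes for free: each of two mutually inverse functors is left adjoint to the other.
-/
theorem nonempty_equivalence {A B : Cocont Q} (F : QFunctor A.cat B.cat) (G : QFunctor B.cat A.cat)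
    (h : (F.comp G).Iso (QFunctor.id A.cat)) (k : (G.comp F).Iso (QFunctor.id B.cat)) :
    Nonempty (A ≌ B) := by
  let F' : A ⟶ B := ⟨F, QFunctor.Adjoint.isCocontinuous (G := G) ⟨h.2, k.1⟩⟩
  let G' : B ⟶ A := ⟨G, QFunctor.Adjoint.isCocontinuous (G := F) ⟨k.2, h.1⟩⟩
  obtain ⟨e₁⟩ := (nonempty_iso_iff (F := 𝟙 A) (G := F' ≫ G')).2 ⟨h.2, h.1⟩
  obtain ⟨e₂⟩ := (nonempty_iso_iff (F := G' ≫ F') (G := 𝟙 B)).2 ⟨k.1, k.2⟩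
  exact ⟨Bicategory.Equivalence.mkOfAdjointifyCounit e₁ e₂⟩

theorem IsProjective.of_equivalence {B : Type*} [Bicategory B] {a b : B} (e : a ≌ b)
    (hb : IsProjective b) : IsProjective a := by
  intro c d f g hg
  obtain ⟨h, ⟨i⟩⟩ := hb c d (e.inv ≫ f) g hg
  exact ⟨e.hom ≫ h, ⟨α_ _ _ _ ≪≫ whiskerLeftIso e.hom i ≪≫ (α_ _ _ _).symm ≪≫
    whiskerRightIso e.unit.symm f ≪≫ λ_ f⟩⟩

end Basic

/-! ### Projectivity, complete distributivity and total continuity. -/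

section Distributive

variable {Q : Type u} [Quantaloid Q]

/-! ### Total continuity and complete distributivity -/

theorem le_totallyBelow {A : Cocont Q} {X Y : Q} {a : A.cat.obj X} {b : A.cat.obj Y}
    {f : X ⟶ Y} :
    f ≤ (totallyBelow A).app b a ↔
      ∀ (W : Q) (φ : Presheaf A.cat.toQSemicategory W),
        A.cat.hom a ((supFunctor A).obj φ) ≫ f ≤ φ.app b := by
  refine le_iInf₂_iff.trans (forall₂_congr fun W φ => ?_)
  rw [le_rightExt]
  change A.cat.hom a ((supFunctor A).obj φ) ≫ f ≤
    (presheafCategory A.cat.toQSemicategory).hom ((yonedaFunctor A.cat).obj b) φ ↔ _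
  rw [yoneda_hom]

/-- The counit of the adjunction between Θ and sup, valid without any continuity assumption: test Θ
against φ itself. -/
theorem totallyBelow_sup_le {A : Cocont Q} {X Y : Q} (φ : Presheaf A.cat.toQSemicategory X)
    (b : A.cat.obj Y) : (totallyBelow A).app b ((supFunctor A).obj φ) ≤ φ.app b := by
  have h := le_totallyBelow.1 (le_refl ((totallyBelow A).app b ((supFunctor A).obj φ))) X φ
  refine le_trans ?_ h
  have k := comp_le_comp_right (A.cat.id_le ((supFunctor A).obj φ))
    ((totallyBelow A).app b ((supFunctor A).obj φ))
  rwa [Category.id_comp] at k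

/-- Test Θ against the representable presheaf of `a`, whose supremum is `a`. -/
theorem totallyBelow_le_hom {A : Cocont Q} {X Y : Q} (a : A.cat.obj X) (b : A.cat.obj Y) :
    (totallyBelow A).app b a ≤ A.cat.hom b a := by
  have h := le_totallyBelow.1 (le_refl ((totallyBelow A).app b a)) X ((yonedaFunctor A.cat).obj a)
  refine le_trans ?_ h
  have k := comp_le_comp_right (le_sup_yoneda A a) ((totallyBelow A).app b a)
  rwa [Category.id_comp] at k

theorem isTotallyCompact_iff {A : Cocont Q} {X : Q} {a : A.cat.obj X} :
    IsTotallyCompact A a ↔ ∀ (W : Q) (φ : Presheaf A.cat.toQSemicategory W),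
      A.cat.hom a ((supFunctor A).obj φ) ≤ φ.app a := by
  refine le_totallyBelow.trans (forall₂_congr fun W φ => ?_)
  rw [Category.comp_id]

/-- It suffices for total continuity that every object is below the supremum of some presheaf of
objects totally below it. -/
theorem isTotallyContinuous_of_le {A : Cocont Q}
    (h : ∀ {X : Q} (a : A.cat.obj X), ∃ φ : Presheaf A.cat.toQSemicategory X,
      (∀ (W : Q) (b : A.cat.obj W), φ.app b ≤ (totallyBelow A).app b a) ∧
        𝟙 X ≤ A.cat.hom a ((supFunctor A).obj φ)) : IsTotallyContinuous A := by
  constructor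
  · intro X a
    exact sup_le_of_le_hom A fun W b => totallyBelow_le_hom a b
  · intro X a
    obtain ⟨φ, hφ, ha⟩ := h a
    exact QCategory.one_le_trans ha (sup_mono A hφ)

theorem IsTotallyContinuous.adjoint {A : Cocont Q} (h : IsTotallyContinuous A) :
    (totallyBelow A).toFunctor.Adjoint (supFunctor A) :=
  ⟨h.2, fun _ φ => Presheaf.one_le_hom.2 fun _ b => totallyBelow_sup_le φ b⟩

theorem IsTotallyContinuous.isWeightedSup {A : Cocont Q} (h : IsTotallyContinuous A) {X : Q}
    (a : A.cat.obj X) :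
    IsWeightedSup A.cat (fun b => b) (fun b => (totallyBelow A).app b a) a :=
  (isWeightedSup_sup A ((totallyBelow A).toFunctor.obj a)).of_iso (h.1 a) (h.2 a)

theorem isCompletelyDistributive_iff {A : Cocont Q} :
    IsCompletelyDistributive A ↔ IsTotallyContinuous A := by
  refine ⟨fun ⟨L, hL⟩ => isTotallyContinuous_of_le fun {X} a =>
    ⟨L.obj a, fun W b => le_totallyBelow.2 fun V φ => ?_, hL.1 a⟩, fun h => ⟨_, h.adjoint⟩⟩
  -- The adjunction gives A(a, sup φ) ≤ P A(L a, φ), which says that L a is below Θ(-, a).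
  exact le_presheafCategory_hom.1 (hL.hom_eq a φ).ge W b

/-- The unit of the adjunction is part of the section property. For the counit, S(sup φ) is the
supremum of the S c weighted by φ(c); as sup(S c) ≅ c, each S c lies below A(-, c), so the whole
lies below φ. -/
theorem isCompletelyDistributive_of_section {A : Cocont Q}
    (S : QFunctor A.cat (presheafCategory A.cat.toQSemicategory)) (hS : IsCocontinuous S)
    (h : (S.comp (supFunctor A)).Iso (QFunctor.id A.cat)) : IsCompletelyDistributive A := by
  refine ⟨S, h.2, fun X φ => Presheaf.one_le_hom.2 fun Y b => ?_⟩
  refine ((hS.map_isWeightedSup A.cocomplete (isWeightedSup_sup A φ)).presheaf_app b).trans_le ?_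
  refine iSup₂_le fun W c => (comp_le_comp_left _ ?_).trans (φ.app_hom_le c b)
  refine ((isWeightedSup_sup A (S.obj c)).weight_le b).trans ?_
  exact QCategory.hom_mono_right (h.1 c) b

/-- The section `S` need not be cocontinuous, so the Yoneda embedding may serve. -/
theorem isEpimorphism_of_section {A B : Cocont Q} (G : A ⟶ B) (S : QFunctor B.cat A.cat)
    (h : (S.comp G.functor).Iso (QFunctor.id B.cat)) : IsEpimorphism G := by
  intro C H K e
  rw [nonempty_iso_iff] at e ⊢
  constructor
  · intro X b
    exact QCategory.one_le_trans ((h.2 b).trans (H.functor.hom_le _ _))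
      (QCategory.one_le_trans (e.1 (S.obj b)) ((h.1 b).trans (K.functor.hom_le _ _)))
  · intro X b
    exact QCategory.one_le_trans ((h.2 b).trans (K.functor.hom_le _ _))
      (QCategory.one_le_trans (e.2 (S.obj b)) ((h.1 b).trans (H.functor.hom_le _ _)))

theorem IsProjective.isCompletelyDistributive {A : Cocont Q} (hA : IsProjective A) :
    IsCompletelyDistributive A := by
  let s : (presheafPseudofunctor Q).obj A.cat ⟶ A := ⟨supFunctor A, isCocontinuous_supFunctor A⟩
  obtain ⟨S, hS⟩ := hA _ _ (𝟙 A) s (isEpimorphism_of_section s (yonedaFunctor A.cat)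
    ⟨fun X a => sup_yoneda_le A a, fun X a => le_sup_yoneda A a⟩)
  exact isCompletelyDistributive_of_section S.functor S.cocontinuous (nonempty_iso_iff.1 hS)

/-! ### Epimorphisms of `Cocont(Q)` -/

/-- The `Q`-category of arrows with domain `X`. -/
abbrev copresheafCategory (X : Q) : QCategory Q where
  obj Y := X ⟶ Y
  hom k h := rightExt h k
  comp_le f g h := by
    rw [le_rightExt, ← Category.assoc]
    exact (comp_le_comp_right (le_rightExt.1 le_rfl) _).trans (le_rightExt.1 le_rfl)
  id_le f := by
    rw [le_rightExt, Category.comp_id]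

/-- The local order here is opposite to that of the hom-lattices of `Q`, so suprema are meets of
liftings. -/
theorem isWeightedSup_copresheafCategory {X : Q} {ι : Q → Type u} {Y : Q}
    (x : ∀ {W : Q}, ι W → (X ⟶ W)) (w : ∀ {W : Q}, ι W → (Y ⟶ W)) :
    IsWeightedSup (copresheafCategory X) x w
      (⨅ (W : Q) (i : ι W), rightLift (w i) (x i) : X ⟶ Y) := by
  intro Z b f
  simp only [le_rightExt, le_iInf_iff, le_rightLift, Category.assoc]

theorem isCocomplete_copresheafCategory (X : Q) : IsCocomplete (copresheafCategory X) := by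
  intro Y C Φ F
  refine ⟨{ obj := fun {W} y => ⨅ (V : Q) (c : C.obj V), rightLift (Φ.app c y) (F.obj c)
            hom_le := fun {V W} z y => ?_ },
    isColimit_iff.2 fun W y => isWeightedSup_copresheafCategory (fun c => F.obj c)
      (fun c => Φ.app c y)⟩
  refine le_rightExt.2 (le_iInf₂ fun U c => le_rightLift.2 ?_)
  rw [Category.assoc]
  exact (comp_le_comp_left _ (Φ.hom_app_le y z c)).trans (le_rightLift.1 (iInf₂_le U c))

/-- The functor `B(-, b)`. -/
def coyonedaFunctor (B : QCategory Q) {X : Q} (b : B.obj X) :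
    QFunctor B (copresheafCategory X) where
  obj c := B.hom c b
  hom_le d c := le_rightExt.2 (B.comp_le b c d)

/-- By definition of a colimit, B(-, b) turns it into a meet of liftings, which is a colimit in the
target. -/
theorem isCocontinuous_coyonedaFunctor (B : QCategory Q) {X : Q} (b : B.obj X) :
    IsCocontinuous (coyonedaFunctor B b) := by
  intro Y C Φ F K hK
  refine isColimit_iff.2 fun W y => ?_
  have e : (coyonedaFunctor B b).obj (K.obj y) = _ := hK y b
  change IsWeightedSup _ _ _ ((coyonedaFunctor B b).obj (K.obj y))
  rw [e]
  exact isWeightedSup_copresheafCategory (fun c => (coyonedaFunctor B b).obj (F.obj c)) _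

/-- The cocontinuous functors B(-, b) and B(-, G H b) agree on the image of `G`, because B(G c, b) =
C(c, H b). As `G` is an epimorphism they agree everywhere, in particular at `b`. -/
theorem IsEpimorphism.one_le {B C : Cocont Q} {G : C ⟶ B} (hG : IsEpimorphism G)
    {H : QFunctor B.cat C.cat}
    (hH : ∀ {X Z : Q} (a : C.cat.obj X) (b : B.cat.obj Z),
      B.cat.hom (G.functor.obj a) b = C.cat.hom a (H.obj b)) {X : Q} (b : B.cat.obj X) :
    𝟙 X ≤ B.cat.hom b (G.functor.obj (H.obj b)) := by
  let D : Cocont Q := ⟨copresheafCategory X, isCocomplete_copresheafCategory X⟩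
  let K (b : B.cat.obj X) : B ⟶ D := ⟨coyonedaFunctor B.cat b, isCocontinuous_coyonedaFunctor _ b⟩
  have e : ∀ {Z : Q} (c : C.cat.obj Z), B.cat.hom (G.functor.obj c) b =
      B.cat.hom (G.functor.obj c) (G.functor.obj (H.obj b)) := by
    intro Z c
    apply le_antisymm
    · rw [hH]
      exact G.functor.hom_le _ _
    · exact QCategory.hom_mono_right ((hH _ b).symm ▸ C.cat.id_le (H.obj b)) _
  have h := hG D (K b) (K (G.functor.obj (H.obj b))) (nonempty_iso_iff.2
    ⟨fun Z c => le_rightExt.2 (by rw [Category.comp_id]; exact (e c).ge),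
      fun Z c => le_rightExt.2 (by rw [Category.comp_id]; exact (e c).le)⟩)
  have h₁ := le_rightExt.1 ((nonempty_iso_iff.1 h).2 b)
  rw [Category.comp_id] at h₁
  exact (B.cat.id_le b).trans h₁

/-- The naive lift H F need not be cocontinuous. It is replaced by a ↦ ⋁_d Θ(d, a) · H F d, a
composite of three cocontinuous functors. -/
theorem IsTotallyContinuous.isProjective {A : Cocont Q} (hA : IsTotallyContinuous A) :
    IsProjective A := by
  intro B C F G hG
  obtain ⟨H, hH⟩ := G.cocontinuous.exists_rightAdjoint C.cocomplete
  have hone {X : Q} (b : B.cat.obj X) := hG.one_le hH b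
  let L : A ⟶ (presheafPseudofunctor Q).obj A.cat :=
    ⟨(totallyBelow A).toFunctor, hA.adjoint.isCocontinuous⟩
  let M : (presheafPseudofunctor Q).obj A.cat ⟶ (presheafPseudofunctor Q).obj C.cat :=
    (presheafPseudofunctor Q).map (F.functor.comp H).graph
  let s : (presheafPseudofunctor Q).obj C.cat ⟶ C := ⟨supFunctor C, isCocontinuous_supFunctor C⟩
  refine ⟨L ≫ M ≫ s, nonempty_iso_iff.2 ?_⟩
  -- Both sides unfold to conditions indexed by the objects d of `A`: the image under `G` of the
  -- lift is the supremum of the G H F d, and F a that of the F d, both weighted by Θ(d, a). They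
  -- agree because G H F d ≅ F d.
  have key : ∀ {X Z : Q} (a : A.cat.obj X) (b : B.cat.obj Z),
      B.cat.hom ((((L ≫ M ≫ s) ≫ G) : A ⟶ B).functor.obj a) b =
        B.cat.hom (F.functor.obj a) b := by
    intro X Z a b
    refine eq_of_forall_le_iff fun f => ?_
    have h₁ := G.cocontinuous.map_isWeightedSup C.cocomplete
      (isWeightedSup_sup C (M.functor.obj (L.functor.obj a))) b f
    have h₂ := F.cocontinuous.map_isWeightedSup A.cocomplete (hA.isWeightedSup a) b f
    refine h₁.trans (Iff.trans ?_ h₂.symm)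
    have h₃ : ∀ {W : Q} (c : C.cat.obj W), (M.functor.obj (L.functor.obj a)).app c =
        ⨆ (V : Q) (d : A.cat.obj V), (totallyBelow A).app d a ≫
          C.cat.hom c (H.obj (F.functor.obj d)) := fun _ => rfl
    simp only [h₃, comp_iSup, iSup_le_iff, ← hH]
    constructor
    · intro h W d
      -- Among all objects of `C` it suffices to test at H F d.
      have k := h W (H.obj (F.functor.obj d)) W d
      refine le_trans (le_trans (comp_le_comp_left f ?_) k)
        (QCategory.hom_mono_left (hone (F.functor.obj d)) b)
      have h₄ : 𝟙 W ≤ B.cat.hom (G.functor.obj (H.obj (F.functor.obj d))) (F.functor.obj d) :=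
        (hH _ _).symm ▸ C.cat.id_le _
      simpa using comp_le_comp_left ((totallyBelow A).app d a) h₄
    · intro h W c V d
      rw [← Category.assoc]
      exact B.cat.comp_le_hom (h V d) le_rfl
  exact ⟨fun X a => (key a (F.functor.obj a)).symm ▸ B.cat.id_le _,
    fun X a => (key a _) ▸ B.cat.id_le _⟩

end Distributive

/-! ### Regular presheaves, total algebraicity, and the local equivalences. -/

section Regular

variable {Q : Type u} [Quantaloid Q]

/-- Passes from a supremum of a bare family to the supremum of the presheaf that the family
generates. -/
theorem IsWeightedSup.le_sup {A : Cocont Q} {ι : Q → Type u} {Y : Q}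
    {x : ∀ {W : Q}, ι W → A.cat.obj W} {w : ∀ {W : Q}, ι W → (Y ⟶ W)} {a : A.cat.obj Y}
    (h : IsWeightedSup A.cat x w a) :
    𝟙 Y ≤ A.cat.hom a ((supFunctor A).obj
      (Presheaf.iSupWeighted (fun i => (yonedaFunctor A.cat).obj (x i)) w)) := by
  refine h.le_of fun W i => le_trans ?_ ((isWeightedSup_sup A _).weight_le (x i))
  exact le_iSup₂_of_le W i (A.cat.le_comp_hom (w i) (x i))

/-! ### Categories of regular presheaves -/

/-- The representable presheaf `B(-, b)` on a regular semicategory. -/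
def regularYoneda (B : RegularQSemicategory Q) {X : Q} (b : B.obj X) :
    (regularPresheafCategory B.toQSemicategory).obj X :=
  ⟨{ app := fun c => B.hom c b
     app_hom_le := fun c d => B.comp_le b c d }, fun c => B.regular b c⟩

/-- The half of the Yoneda lemma that survives without identities. -/
theorem app_le_regularYoneda_hom (B : RegularQSemicategory Q) {X Y : Q} (b : B.obj Y)
    (φ : (regularPresheafCategory B.toQSemicategory).obj X) :
    φ.1.app b ≤ (regularPresheafCategory B.toQSemicategory).hom (regularYoneda B b) φ :=
  le_presheafCategory_hom.2 fun _ c => φ.1.app_hom_le b c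

/-- Regularity of φ replaces the missing half of the Yoneda lemma: φ(c) is the join of the
composites of φ(b) with B(c, b). -/
theorem isWeightedSup_regularYoneda (B : RegularQSemicategory Q) {X : Q}
    (φ : (regularPresheafCategory B.toQSemicategory).obj X) :
    IsWeightedSup (regularPresheafCategory B.toQSemicategory) (fun b => regularYoneda B b)
      (fun b => φ.1.app b) φ := by
  intro Z ψ f
  refine (le_presheafCategory_hom (φ := ψ.1) (ψ := φ.1)).trans ⟨fun h W b => ?_, fun h W c => ?_⟩
  · exact (h W b).trans (app_le_regularYoneda_hom B b ψ)
  · rw [← φ.2 c, comp_iSup]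
    refine iSup_le fun V => ?_
    rw [comp_iSup]
    refine iSup_le fun b => ?_
    rw [← Category.assoc]
    exact le_presheafCategory_hom.1 (h V b) W c

/-- The presheaf generated by the representables B(-, b) with weights φ(b) lies totally below φ.
Indeed R B(φ, sup Ψ) followed by φ(b) lands in (sup Ψ)(b), which pointwise is a join of Ψ(ω)
followed by ω(b), and ω(b) ≤ R B(B(-, b), ω). -/
theorem isTotallyContinuous_regularPresheafCategory (B : RSDistCat Q) :
    IsTotallyContinuous ((regularPseudofunctor Q).obj B) := by
  refine isTotallyContinuous_of_le fun {X} φ =>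
    ⟨_, fun W χ => le_totallyBelow.2 fun V Ψ => ?_, (isWeightedSup_regularYoneda B φ).le_sup⟩
  let R := (regularPseudofunctor Q).obj B
  let σ := (supFunctor R).obj Ψ
  simp only [Presheaf.iSupWeighted, comp_iSup]
  refine iSup₂_le fun U b => ?_
  rw [← Category.assoc]
  have h₁ : R.cat.hom φ σ ≫ φ.1.app b ≤ σ.1.app b :=
    le_presheafCategory_hom.1 (le_refl (R.cat.hom φ σ)) U b
  refine (comp_le_comp_right h₁ _).trans ?_
  rw [(isWeightedSup_sup R Ψ).regularPresheaf_app b]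
  simp only [iSup_comp, Category.assoc]
  refine iSup₂_le fun T ω => (comp_le_comp_left _ ?_).trans (Ψ.app_hom_le ω χ)
  exact R.cat.comp_le_hom (app_le_regularYoneda_hom B b ω) le_rfl

/-- The objects of a totally continuous category, with the totally-below relation. -/
noncomputable def totallyBelowSemicategory {A : Cocont Q} (hA : IsTotallyContinuous A) :
    RegularQSemicategory Q where
  obj := A.cat.obj
  hom b a := (totallyBelow A).app b a
  comp_le a b c := (comp_le_comp_left _ (totallyBelow_le_hom b c)).trans
    ((totallyBelow A).app_hom_le a b c)
  -- Interpolation: the left adjoint Θ preserves the supremum expressing `a` through the objects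
  -- totally below it.
  regular a c := ((hA.adjoint.isCocontinuous.map_isWeightedSup A.cocomplete
    (hA.isWeightedSup a)).presheaf_app c).symm

theorem IsTotallyContinuous.exists_equivalence {A : Cocont Q} (hA : IsTotallyContinuous A) :
    ∃ B : RSDistCat Q, Nonempty (A ≌ (regularPseudofunctor Q).obj B) := by
  let B := totallyBelowSemicategory hA
  let F : QFunctor A.cat (regularPresheafCategory B.toQSemicategory) :=
    { obj := fun a => regularYoneda B a
      hom_le := fun b a => le_presheafCategory_hom.2 fun W c =>
        (totallyBelow A).hom_app_le a b c }
  -- Regularity writes ψ as Θ ⊗ ψ, and Θ absorbs the homs of `A`, so ψ is also a presheaf on `A`.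
  let E {X : Q} (ψ : (regularPresheafCategory B.toQSemicategory).obj X) :
      Presheaf A.cat.toQSemicategory X :=
    { app := fun a => ψ.1.app a
      app_hom_le := fun a b => by
        rw [← ψ.2 a]
        simp only [iSup_comp, Category.assoc]
        exact iSup₂_le fun W c => (comp_le_comp_left _ ((totallyBelow A).app_hom_le c a b)).trans
          (ψ.1.app_hom_le c b) }
  let G : QFunctor (regularPresheafCategory B.toQSemicategory) A.cat :=
    { obj := fun ψ => (supFunctor A).obj (E ψ)
      hom_le := fun ψ φ => (supFunctor A).hom_le (E ψ) (E φ) }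
  -- Θ preserves the supremum of ψ, so Θ(-, sup ψ) = Θ ⊗ ψ, and this is ψ by regularity.
  have key : ∀ {X Y : Q} (ψ : (regularPresheafCategory B.toQSemicategory).obj X) (b : A.cat.obj Y),
      (totallyBelow A).app b (G.obj ψ) = ψ.1.app b := by
    intro X Y ψ b
    refine ((hA.adjoint.isCocontinuous.map_isWeightedSup A.cocomplete
      (isWeightedSup_sup A (E ψ))).presheaf_app b).trans ?_
    exact ψ.2 b
  refine ⟨B, nonempty_equivalence F G ⟨hA.1, hA.2⟩ ⟨fun X ψ => ?_, fun X ψ => ?_⟩⟩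
  · exact Presheaf.one_le_hom.2 fun Y b => (key ψ b).le
  · exact Presheaf.one_le_hom.2 fun Y b => (key ψ b).ge

theorem tfae_isTotallyContinuous (A : Cocont Q) :
    [ IsProjective A,
      IsCompletelyDistributive A,
      IsTotallyContinuous A,
      ∃ B : RSDistCat Q, Nonempty (A ≌ (regularPseudofunctor Q).obj B) ].TFAE := by
  tfae_have 1 → 2 := IsProjective.isCompletelyDistributive
  tfae_have 2 ↔ 3 := isCompletelyDistributive_iff
  tfae_have 3 → 4 := IsTotallyContinuous.exists_equivalence
  tfae_have 4 → 1 := fun ⟨B, ⟨e⟩⟩ =>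
    IsProjective.of_equivalence e (isTotallyContinuous_regularPresheafCategory B).isProjective
  tfae_finish

theorem regularMap_regularYoneda {A B : RegularQSemicategory Q} (Φ : RegularDistributor A B)
    {X Y : Q} (a : A.obj X) (b : B.obj Y) :
    ((regularMap Φ).obj (regularYoneda A a)).1.app b = Φ.app b a :=
  congrArg (fun Ψ : Distributor A.toQSemicategory B.toQSemicategory => Ψ.app b a) Φ.homs_comp

/-- The regular semidistributor induced by a cocontinuous functor between categories of regular
presheaves. -/
def regularDistributorOfFunctor {A B : RegularQSemicategory Q}
    (G : QFunctor (regularPresheafCategory A.toQSemicategory)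
      (regularPresheafCategory B.toQSemicategory)) (hG : IsCocontinuous G) :
    RegularDistributor A B where
  app b a := (G.obj (regularYoneda A a)).1.app b
  app_hom_le a b c := (G.obj (regularYoneda A a)).1.app_hom_le b c
  hom_app_le a b c := le_presheafCategory_hom.1
    ((app_le_regularYoneda_hom A b (regularYoneda A a)).trans (G.hom_le _ _)) _ c
  homs_comp := by
    refine Distributor.ext ?_
    funext X Y c a
    -- Each representable is a supremum of representables, and `G` preserves it.
    exact ((hG.map_isWeightedSup (isCocomplete_regularPresheafCategory _)
      (isWeightedSup_regularYoneda A (regularYoneda A a))).regularPresheaf_app c).symm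
  comp_homs := by
    refine Distributor.ext ?_
    funext X Y c a
    exact (G.obj (regularYoneda A a)).2 c

/-- Both functors preserve the presentation of a regular presheaf as a supremum of representables.
-/
theorem regularMap_regularDistributorOfFunctor {A B : RegularQSemicategory Q}
    (G : QFunctor (regularPresheafCategory A.toQSemicategory)
      (regularPresheafCategory B.toQSemicategory)) (hG : IsCocontinuous G) :
    regularMap (regularDistributorOfFunctor G hG) = G := by
  refine QFunctor.ext ?_
  funext X φ
  refine Subtype.ext (Presheaf.ext ?_)
  funext Y b
  exact ((hG.map_isWeightedSup (isCocomplete_regularPresheafCategory _)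
    (isWeightedSup_regularYoneda A φ)).regularPresheaf_app b).symm

theorem isEquivalence_mapFunctor_regular (A B : RSDistCat Q) :
    ((regularPseudofunctor Q).mapFunctor A B).IsEquivalence where
  faithful := ⟨fun _ => Subsingleton.elim _ _⟩
  full := ⟨fun {Φ Ψ} η => ⟨homOfLE fun X Y b a => by
    rw [← regularMap_regularYoneda Φ a b, ← regularMap_regularYoneda Ψ a b]
    exact Presheaf.one_le_hom.1 (leOfHom η (regularYoneda A a)) Y b, Subsingleton.elim _ _⟩⟩
  essSurj := ⟨fun G => ⟨regularDistributorOfFunctor G.functor G.cocontinuous,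
    ⟨eqToIso (CocontFunctor.ext (regularMap_regularDistributorOfFunctor G.functor _))⟩⟩⟩

/-! ### Categories of presheaves -/

theorem presheafMap_yoneda {A : QCategory Q} {B : QSemicategory Q}
    (Φ : Distributor A.toQSemicategory B) {X Y : Q} (a : A.obj X) (b : B.obj Y) :
    ((presheafMap Φ).obj ((yonedaFunctor A).obj a)).app b = Φ.app b a :=
  congrArg (fun Ψ : Distributor A.toQSemicategory B => Ψ.app b a) (Distributor.homs_comp A Φ)

/-- The distributor induced by a functor between presheaf categories. -/
def distributorOfFunctor {A : QCategory Q} {B : QSemicategory Q}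
    (G : QFunctor (presheafCategory A.toQSemicategory) (presheafCategory B)) :
    Distributor A.toQSemicategory B where
  app b a := (G.obj ((yonedaFunctor A).obj a)).app b
  app_hom_le a b c := (G.obj ((yonedaFunctor A).obj a)).app_hom_le b c
  hom_app_le a b c := le_presheafCategory_hom.1
    (((yonedaFunctor A).hom_le b a).trans (G.hom_le _ _)) _ c

theorem presheafMap_distributorOfFunctor {A : QCategory Q} {B : QSemicategory Q}
    (G : QFunctor (presheafCategory A.toQSemicategory) (presheafCategory B))
    (hG : IsCocontinuous G) : presheafMap (distributorOfFunctor G) = G := by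
  refine QFunctor.ext ?_
  funext X φ
  refine Presheaf.ext ?_
  funext Y b
  exact ((hG.map_isWeightedSup (isCocomplete_presheafCategory _)
    (Presheaf.isWeightedSup_yoneda A φ)).presheaf_app b).symm

theorem isEquivalence_mapFunctor_presheaf (A B : DistCat Q) :
    ((presheafPseudofunctor Q).mapFunctor A B).IsEquivalence where
  faithful := ⟨fun _ => Subsingleton.elim _ _⟩
  full := ⟨fun {Φ Ψ} η => ⟨homOfLE fun X Y b a => by
    rw [← presheafMap_yoneda Φ a b, ← presheafMap_yoneda Ψ a b]
    exact Presheaf.one_le_hom.1 (leOfHom η ((yonedaFunctor A).obj a)) Y b,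
      Subsingleton.elim _ _⟩⟩
  essSurj := ⟨fun G => ⟨distributorOfFunctor G.functor,
    ⟨eqToIso (CocontFunctor.ext (presheafMap_distributorOfFunctor G.functor G.cocontinuous))⟩⟩⟩

/-! ### Total algebraicity -/

/-- For totally compact c, composing A(c, a) with 1 ≤ Θ(c, c) gives A(c, a) ≤ Θ(c, a), and Θ absorbs
A(b, c). -/
theorem compactBelow_le_totallyBelow {A : Cocont Q} {X Y : Q} (a : A.cat.obj X)
    (b : A.cat.obj Y) : (compactBelow A).app b a ≤ (totallyBelow A).app b a := by
  refine iSup₂_le fun W c => ?_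
  have h₁ : A.cat.hom c.1 a ≤ (totallyBelow A).app c.1 a := by
    refine le_trans ?_ ((totallyBelow A).hom_app_le a c.1 c.1)
    simpa using comp_le_comp_left (A.cat.hom c.1 a) c.2
  exact (comp_le_comp_right h₁ _).trans ((totallyBelow A).app_hom_le a c.1 b)

theorem IsTotallyAlgebraic.isTotallyContinuous {A : Cocont Q} (hA : IsTotallyAlgebraic A) :
    IsTotallyContinuous A :=
  isTotallyContinuous_of_le fun a => ⟨(compactBelow A).toFunctor.obj a,
    fun _ b => compactBelow_le_totallyBelow a b, hA.2 a⟩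

theorem IsTotallyAlgebraic.exists_equivalence {A : Cocont Q} (hA : IsTotallyAlgebraic A) :
    ∃ C : DistCat Q, Nonempty (A ≌ (presheafPseudofunctor Q).obj C) := by
  let C := compactObjects A
  let i := compactInclusion A
  let F : QFunctor A.cat (presheafCategory C.toQSemicategory) := i.cograph.toFunctor
  let G : QFunctor (presheafCategory C.toQSemicategory) A.cat :=
    (presheafMap i.graph).comp (supFunctor A)
  refine ⟨C, nonempty_equivalence F G ⟨hA.1, hA.2⟩ ⟨fun X φ => ?_, fun X φ => ?_⟩⟩
  · refine Presheaf.one_le_hom.2 fun Y c => ?_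
    -- Compactness of `c` bounds A(c, sup φ̂) by φ̂(c), where φ̂ extends φ to `A`; at a totally
    -- compact object φ̂ does not exceed φ.
    refine (isTotallyCompact_iff.1 c.2 X (φ.map i.graph)).trans ?_
    exact iSup₂_le fun W d => φ.app_hom_le d c
  · refine Presheaf.one_le_hom.2 fun Y c => ?_
    refine le_trans ?_ ((isWeightedSup_sup A (φ.map i.graph)).weight_le c.1)
    exact le_iSup₂_of_le Y c (A.cat.le_comp_hom (φ.app c) c.1)

theorem isTotallyAlgebraic_of_equivalence {A : Cocont Q} {C : DistCat Q}
    (e : A ≌ (presheafPseudofunctor Q).obj C) : IsTotallyAlgebraic A := by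
  have h₁ := nonempty_iso_iff.1 ⟨e.unit⟩
  have h₂ := nonempty_iso_iff.1 ⟨e.counit⟩
  let F := e.hom.functor
  let G := e.inv.functor
  -- The images of the representables are totally compact, since A(j c, -) is evaluation at `c`
  -- after `F`, and this preserves suprema. Every a ≅ G F a is a supremum of them.
  let j {X : Q} (c : (QCategory.toQSemicategory C).obj X) : A.cat.obj X :=
    G.obj ((yonedaFunctor C).obj c)
  have hG : G.Adjoint F := ⟨h₂.2, h₁.2⟩
  have hj : ∀ {X Y : Q} (c : (QCategory.toQSemicategory C).obj X) (a : A.cat.obj Y),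
      A.cat.hom (j c) a = (F.obj a).app c := fun c a =>
    (hG.hom_eq _ a).trans (yoneda_hom C c (F.obj a))
  have hc : ∀ {X : Q} (c : (QCategory.toQSemicategory C).obj X), IsTotallyCompact A (j c) := by
    intro X c
    refine isTotallyCompact_iff.2 fun W φ => ?_
    rw [hj, (e.hom.cocontinuous.map_isWeightedSup A.cocomplete
      (isWeightedSup_sup A φ)).presheaf_app c]
    refine iSup₂_le fun V a => (comp_le_comp_left _ ?_).trans (φ.app_hom_le a (j c))
    exact (hj c a).ge
  constructor
  · intro X a
    exact sup_le_of_le_hom A fun W b =>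
      (compactBelow_le_totallyBelow a b).trans (totallyBelow_le_hom a b)
  · intro X a
    have h := e.inv.cocontinuous.map_isWeightedSup (isCocomplete_presheafCategory _)
      (Presheaf.isWeightedSup_yoneda C (F.obj a))
    have k : IsWeightedSup A.cat (fun c => j c) (fun c => (F.obj a).app c) a :=
      h.of_iso (h₁.2 a) (h₁.1 a)
    refine QCategory.one_le_trans k.le_sup (sup_mono A fun W b => ?_)
    refine iSup₂_le fun V c => ?_
    exact (comp_le_comp_right (hj c a).ge _).trans (le_iSup₂_of_le V ⟨j c, hc c⟩ le_rfl)

theorem isTotallyAlgebraic_iff (A : Cocont Q) :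
    IsTotallyAlgebraic A ↔ ∃ C : DistCat Q, Nonempty (A ≌ (presheafPseudofunctor Q).obj C) :=
  ⟨IsTotallyAlgebraic.exists_equivalence, fun ⟨_, ⟨e⟩⟩ => isTotallyAlgebraic_of_equivalence e⟩

end Regular

/-! ### Full sub-bicategories, and transformations into locally ordered bicategories. -/

section Biequivalence

universe w₁ w₂ v₁ v₂ u₁ u₂

variable {B : Type u₁} [Bicategory.{w₁, v₁} B] {C : Type u₂} [Bicategory.{w₂, v₂} C]

theorem isBiequivalence_corestrict (F : B ⥤ᵖ C) (P : C → Prop) (h : ∀ b, P (F.obj b))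
    (hF : ∀ a b : B, (F.mapFunctor a b).IsEquivalence)
    (hP : ∀ c : C, P c → ∃ b : B, Nonempty (F.obj b ≌ c)) :
    IsBiequivalence (corestrict F P h) := by
  refine ⟨fun a b => ?_, fun c => ?_⟩
  · have := hF a b
    refine
      { faithful := ⟨fun {f g η θ} e => ?_⟩
        full := ⟨fun {f g} η => ?_⟩
        essSurj := ⟨fun g => ?_⟩ }
    · have e₁ := congrArg InducedBicategory.Hom₂.hom e
      exact (F.mapFunctor a b).map_injective e₁
    · obtain ⟨θ, hθ⟩ := (F.mapFunctor a b).map_surjective η.hom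
      exact ⟨θ, InducedBicategory.hom₂_ext hθ⟩
    · exact ⟨(F.mapFunctor a b).objPreimage g.hom,
        ⟨InducedBicategory.isoMk ((F.mapFunctor a b).objObjPreimageIso g.hom)⟩⟩
  · obtain ⟨b, ⟨e⟩⟩ := hP c.1 c.2
    let f : (corestrict F P h).obj b ⟶ c := InducedBicategory.mkHom e.hom
    let g : c ⟶ (corestrict F P h).obj b := InducedBicategory.mkHom e.inv
    let η : 𝟙 ((corestrict F P h).obj b) ≅ f ≫ g := InducedBicategory.isoMk e.unit
    let κ : g ≫ f ≅ 𝟙 c := InducedBicategory.isoMk e.counit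
    exact ⟨b, ⟨Bicategory.Equivalence.mkOfAdjointifyCounit η κ⟩⟩

theorem isFullInclusion_fullSubInclusion {P P₁ : C → Prop} (h : ∀ c, P c → P₁ c) :
    IsFullInclusion (fullSubInclusion h) := by
  refine ⟨fun a b e => ?_, fun a b => ⟨⟨fun f g e => ?_,
    fun f => ⟨InducedBicategory.mkHom f.hom, rfl⟩⟩, ⟨fun {f g} η => ?_⟩, ⟨fun {f g η θ} e => ?_⟩⟩⟩
  · have e₁ := congrArg Subtype.val e
    exact Subtype.ext e₁
  · have e₁ := congrArg InducedBicategory.Hom.hom e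
    exact InducedBicategory.hom_ext e₁
  · exact ⟨⟨η.hom⟩, rfl⟩
  · have e₁ := congrArg InducedBicategory.Hom₂.hom e
    exact InducedBicategory.hom₂_ext e₁

instance {P : C → Prop} [∀ {a b : C} (f g : a ⟶ b), Subsingleton (f ⟶ g)] {a b : FullSub P}
    (f g : a ⟶ b) : Subsingleton (f ⟶ g) :=
  ⟨fun _ _ => InducedBicategory.hom₂_ext (Subsingleton.elim _ _)⟩

/-- A strong transformation into a locally ordered bicategory. -/
def strongTransOfSubsingleton [∀ {a b : C} (f g : a ⟶ b), Subsingleton (f ⟶ g)] {F G : B ⥤ᵖ C}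
    (app : ∀ a, F.obj a ⟶ G.obj a)
    (naturality : ∀ {a b : B} (f : a ⟶ b), F.map f ≫ app b ≅ app a ≫ G.map f) : F ⟶ G where
  app := app
  naturality := naturality
  naturality_naturality _ := Subsingleton.elim _ _
  naturality_id _ := Subsingleton.elim _ _
  naturality_comp _ _ := Subsingleton.elim _ _

end Biequivalence

/-! ### The inclusions and the commuting square. -/

section Main

variable {Q : Type u} [Quantaloid Q]

theorem isFullInclusion_distInclusion : IsFullInclusion (distInclusion Q) := by
  refine ⟨fun A B e => ?_, fun A B => ⟨⟨fun Φ Ψ e => ?_, fun Φ => ⟨Φ.toDistributor, rfl⟩⟩,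
    ⟨fun {Φ Ψ} η => ⟨homOfLE (leOfHom η), Subsingleton.elim _ _⟩⟩,
    ⟨fun {Φ Ψ η θ} _ => Preorder.subsingleton_hom Φ Ψ |>.elim η θ⟩⟩⟩
  -- Having identities is a property of a semicategory, so the underlying semicategory determines
  -- the category.
  · have h := congrArg RegularQSemicategory.toQSemicategory e
    cases A
    cases B
    cases h
    rfl
  · exact congrArg RegularDistributor.toDistributor e

theorem isCocontinuous_regularInclusion (A : QCategory Q) :
    IsCocontinuous (regularInclusion A.toQSemicategory) :=
  isCocontinuous_of_homs _ (fun φ => (presheafToRegular A).obj φ) fun _ _ => rfl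

theorem exists_presheaf_equivalence_regular
    (hR : ∀ B : RSDistCat Q, IsTotallyContinuous ((regularPseudofunctor Q).obj B))
    (hP : ∀ C : DistCat Q, IsTotallyAlgebraic ((presheafPseudofunctor Q).obj C))
    (hI : ∀ A : Cocont Q, IsTotallyAlgebraic A → IsTotallyContinuous A) :
    ∃ e : (corestrict (presheafPseudofunctor Q) IsTotallyAlgebraic hP).comp
          (fullSubInclusion hI) ≌
        (distInclusion Q).comp (corestrict (regularPseudofunctor Q) IsTotallyContinuous hR),
      ∀ C : DistCat Q, (e.hom.app C).hom.functor = presheafToRegular C := by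
  let F := (corestrict (presheafPseudofunctor Q) IsTotallyAlgebraic hP).comp (fullSubInclusion hI)
  let G := (distInclusion Q).comp (corestrict (regularPseudofunctor Q) IsTotallyContinuous hR)
  let f : F ⟶ G := strongTransOfSubsingleton
    (fun A => InducedBicategory.mkHom
      ⟨presheafToRegular A, isCocontinuous_presheafToRegular A⟩)
    -- Both legs of the square send φ to Φ ⊗ φ, so naturality holds strictly.
    (fun Φ => InducedBicategory.isoMk (eqToIso rfl))
  let g : G ⟶ F := strongTransOfSubsingleton
    (fun A => InducedBicategory.mkHom
      ⟨regularInclusion A.toQSemicategory, isCocontinuous_regularInclusion A⟩)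
    (fun Φ => InducedBicategory.isoMk (eqToIso rfl))
  let η : 𝟙 F ≅ f ≫ g := Pseudofunctor.StrongTrans.isoMk
    (fun A => InducedBicategory.isoMk (eqToIso rfl)) (fun _ => Subsingleton.elim _ _)
  let κ : g ≫ f ≅ 𝟙 G := Pseudofunctor.StrongTrans.isoMk
    (fun A => InducedBicategory.isoMk (eqToIso rfl)) (fun _ => Subsingleton.elim _ _)
  exact ⟨Bicategory.Equivalence.mkOfAdjointifyCounit η κ, fun C => rfl⟩

end Main

end QEnriched

/-- Characterizations of totally continuous and totally algebraic cocomplete `Q`-categories, and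
the resulting biequivalences. -/
theorem mainTheorem1 {Q : Type u} [Quantaloid Q] :
    (∀ A : Cocont Q,
      [ IsProjective A,
        IsCompletelyDistributive A,
        IsTotallyContinuous A,
        ∃ B : RSDistCat Q, Nonempty (A ≌ (regularPseudofunctor Q).obj B) ].TFAE) ∧
    (∀ A : Cocont Q,
      IsTotallyAlgebraic A ↔ ∃ C : DistCat Q, Nonempty (A ≌ (presheafPseudofunctor Q).obj C)) ∧
    ∃ (hR : ∀ B : RSDistCat Q, IsTotallyContinuous ((regularPseudofunctor Q).obj B))
      (hP : ∀ C : DistCat Q, IsTotallyAlgebraic ((presheafPseudofunctor Q).obj C))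
      (hI : ∀ A : Cocont Q, IsTotallyAlgebraic A → IsTotallyContinuous A),
      IsBiequivalence (corestrict (regularPseudofunctor Q) IsTotallyContinuous hR) ∧
      IsBiequivalence (corestrict (presheafPseudofunctor Q) IsTotallyAlgebraic hP) ∧
      IsFullInclusion (distInclusion Q) ∧
      IsFullInclusion (fullSubInclusion hI) ∧
      ∃ e : (corestrict (presheafPseudofunctor Q) IsTotallyAlgebraic hP).comp
            (fullSubInclusion hI) ≌
          (distInclusion Q).comp (corestrict (regularPseudofunctor Q) IsTotallyContinuous hR),
        ∀ C : DistCat Q, (e.hom.app C).hom.functor = presheafToRegular C := by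
  have hI : ∀ A : Cocont Q, IsTotallyAlgebraic A → IsTotallyContinuous A :=
    fun _ hA => hA.isTotallyContinuous
  have hP : ∀ C : DistCat Q, IsTotallyAlgebraic ((presheafPseudofunctor Q).obj C) :=
    fun _ => isTotallyAlgebraic_of_equivalence (Bicategory.Equivalence.id _)
  have hR := isTotallyContinuous_regularPresheafCategory (Q := Q)
  refine ⟨tfae_isTotallyContinuous, isTotallyAlgebraic_iff, hR, hP, hI,
    isBiequivalence_corestrict _ _ hR isEquivalence_mapFunctor_regular fun A hA => ?_,
    isBiequivalence_corestrict _ _ hP isEquivalence_mapFunctor_presheaf fun A hA => ?_,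
    isFullInclusion_distInclusion, isFullInclusion_fullSubInclusion hI,
    exists_presheaf_equivalence_regular hR hP hI⟩
  · obtain ⟨B, ⟨e⟩⟩ := hA.exists_equivalence
    exact ⟨B, ⟨.mkOfAdjointifyCounit e.counit.symm e.unit.symm⟩⟩
  · obtain ⟨C, ⟨e⟩⟩ := hA.exists_equivalence
    exact ⟨C, ⟨.mkOfAdjointifyCounit e.counit.symm e.unit.symm⟩⟩
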